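/- **Theorem 4.1.** Let $m\ge p\ge 2$, and let $\psi=(P_1,\dots,P_p):(\mathbb R^m,0)\to(\mathbb R^p,0)$ be a real analytic map germ that is weighted-homogeneous of positive integer weights $w_1,\dots,w_m$ and positive integer degree $\alpha$, i.e. $P_i(t^{w_1}x_1,\dots,t^{w_m}x_m)=t^{\alpha}P_i(x)$ for all $i$, all $x$ near $0$ and all $0<t\le 1$. Assume that $\psi$ has an isolated singularity at $0$: for $x\neq 0$ near $0$ the gradients $\nabla P_1(x),\dots,\nabla P_p(x)$ are linearly independent. For $\varepsilon>0$ write $\bar B_\varepsilon\subset\mathbb R^m$ for the closed ball and $S_\varepsilon$ for the sphere of radius $\varepsilon$ about $0$, put $K_\varepsilon=S_\varepsilon\cap\{\psi=0\}$, and let $S^{p-1}\subset\mathbb R^p$ be the unit sphere and $B^p$ the open unit ball. An *open book decomposition* of $S_\varepsilon$ with binding $K_\varepsilon$ is a map $\theta:S_\varepsilon\setminus K_\varepsilon\to S^{p-1}$ such that $K_\varepsilon$ is a (possibly empty) closed smooth submanifold of $S_\varepsilon$ of codimension $p$, $\theta$ is a surjective $C^\infty$ locally trivial fibration, and $K_\varepsilon$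 has an open neighbourhood $N$ in $S_\varepsilon$ with a diffeomorphism $N\simeq B^p\times K_\varepsilon$ sending $x\in K_\varepsilon$ to $(0,x)$, under which $\theta|_{N\setminus K_\varepsilon}$ becomes $(y,x)\mapsto y/\|y\|$. Two such decompositions $\theta,\theta'$ are *equivalent* if $\theta'\circ\Phi=\theta$ on $S_\varepsilon\setminus K_\varepsilon$ for some diffeomorphism $\Phi$ of $S_\varepsilon$ with $\Phi(K_\varepsilon)=K_\varepsilon$. For $\eta>0$, an *inflating field* is a vector field $v$, smooth on a neighbourhood of $\bar B_\varepsilon\setminus\{\psi=0\}$, with $\langle v(x),x\rangle>0$ and $\langle v(x),\nabla\|\psi\|^2(x)\rangle>0$ for all $x\in\bar B_\varepsilon$ with $\psi(x)\ne 0$, and with $d\psi_x(v(x))\in\mathbb R\,\psi(x)$ for all $x$ in a neighbourhood of $S_\varepsilon\cap\{\|\psi\|=\eta\}$. A *Milnor map* for $(\varepsilon,\eta,v)$ is a map $\theta$ on $S_\varepsilon\setminus K_\varepsilon$ such that $\theta=\psi/\|\psi\|$ where $0<\|\psi\|\le\eta$, and such that every $x\in S_\varepsilon$ with $\|\psi(x)\|\ge\eta$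 is the end point of an integral curve of $v$ that lies in $\bar B_\varepsilon\cap\{\|\psi\|\ge\eta\}$ and starts at a point $y$ with $\|\psi(y)\|=\eta$ and $\theta(x)=\psi(y)/\|\psi(y)\|$. Then there is $\varepsilon_0>0$ such that, for every $0<\varepsilon\le\varepsilon_0$: 1. $\psi/\|\psi\|:S_\varepsilon\setminus K_\varepsilon\to S^{p-1}$ is an open book decomposition of $S_\varepsilon$ with binding $K_\varepsilon$; 2. there is $\eta_0>0$ such that, for every $0<\eta\le\eta_0$, inflating fields exist, and for every inflating field $v$ a Milnor map for $(\varepsilon,\eta,v)$ exists; every such Milnor map is an open book decomposition of $S_\varepsilon$ with binding $K_\varepsilon$ and is equivalent to the one in 1. -/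

import Mathlib

open Set Filter Topology Metric
open scoped ContDiff

namespace HigherOpenBook

/-- Euclidean space `ℝⁿ`. -/
abbrev Euc (n : ℕ) : Type := EuclideanSpace ℝ (Fin n)

section Diffeo

variable {X Y : Type*} [NormedAddCommGroup X] [NormedSpace ℝ X]
  [NormedAddCommGroup Y] [NormedSpace ℝ Y]

/-- `f` restricts to a `C^∞` diffeomorphism from `A ⊆ X` onto `B ⊆ Y`.
The sets to which this is applied are embedded submanifolds of Euclidean spaces
(spheres, open subsets of spheres, fibres, bindings, and products of these); on an embedded
submanifold, `ContDiffOn` is smoothness in the usual sense: a map that locally extends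
smoothly to the ambient space is `ContDiffOn`, and a `ContDiffOn` map becomes smooth when
composed with the smooth local parametrizations of the submanifold. -/
def IsDiffeoOn (f : X → Y) (A : Set X) (B : Set Y) : Prop :=
  ContDiffOn ℝ ∞ f A ∧ MapsTo f A B ∧
    ∃ g : Y → X, ContDiffOn ℝ ∞ g B ∧ MapsTo g B A ∧ InvOn g f A B

/-- `θ` restricts to a `C^∞` locally trivial fibration of `A ⊆ X` onto `B ⊆ Y`: it is a smooth
surjection, and each `b ∈ B` has an open neighbourhood `U` in `B` for which there is a
diffeomorphism from `θ⁻¹(U)` onto `U × θ⁻¹(b)` that commutes with the projections to `U`. -/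
def IsSmoothFibration (θ : X → Y) (A : Set X) (B : Set Y) : Prop :=
  ContDiffOn ℝ ∞ θ A ∧ MapsTo θ A B ∧ SurjOn θ A B ∧
    ∀ b ∈ B, ∃ U : Set Y, IsOpen U ∧ b ∈ U ∧
      ∃ φ : X → Y × X,
        IsDiffeoOn φ (A ∩ θ ⁻¹' U) ((B ∩ U) ×ˢ (A ∩ θ ⁻¹' {b})) ∧
        ∀ x ∈ A ∩ θ ⁻¹' U, (φ x).1 = θ x

end Diffeo

variable {m p : ℕ}

/-- `K` is a closed smooth submanifold of codimension `p` of the sphere of radius `ε` about the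
origin of `ℝᵐ`: it is a closed subset of the sphere which near each of its points is the zero set
in the sphere of a smooth `ℝᵖ`-valued map whose differential maps the tangent space of the sphere
(the orthogonal complement of the position vector) onto `ℝᵖ` at every point of `K`. -/
def IsSubmanifoldOfSphere (p : ℕ) (ε : ℝ) (K : Set (Euc m)) : Prop :=
  IsClosed K ∧ K ⊆ sphere 0 ε ∧
    ∀ x ∈ K, ∃ U : Set (Euc m), IsOpen U ∧ x ∈ U ∧
      ∃ g : Euc m → Euc p, ContDiffOn ℝ ∞ g U ∧
        K ∩ U = {y | y ∈ sphere 0 ε ∧ y ∈ U ∧ g y = 0} ∧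
        ∀ y ∈ K ∩ U, ∀ c : Euc p, ∃ h : Euc m, inner ℝ y h = 0 ∧ fderiv ℝ g y h = c

/-- `(K, θ)` is a (higher) open book structure, with binding `K` of codimension `p`, of the sphere
of radius `ε` about the origin of `ℝᵐ`. Only the values of `θ` on the complement of `K` in the
sphere matter. The last clause: `K` has an open neighbourhood `N` in the sphere with a
diffeomorphism `N ≃ Bᵖ × K` which identifies `K` with `{0} × K`, and `θ` is on `N ∖ K` the
composite `N ∖ K ≃ (Bᵖ ∖ {0}) × K → Bᵖ ∖ {0} → Sᵖ⁻¹`. -/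
structure IsOpenBook (ε : ℝ) (K : Set (Euc m)) (θ : Euc m → Euc p) : Prop where
  binding : IsSubmanifoldOfSphere p ε K
  fibration : IsSmoothFibration θ (sphere 0 ε \ K) (sphere 0 1)
  near_binding : ∃ W : Set (Euc m), IsOpen W ∧ K ⊆ W ∧
    ∃ φ : Euc m → Euc p × Euc m,
      IsDiffeoOn φ (sphere 0 ε ∩ W) (ball 0 1 ×ˢ K) ∧
      (∀ x ∈ K, φ x = (0, x)) ∧
      ∀ x ∈ (sphere 0 ε ∩ W) \ K, θ x = ‖(φ x).1‖⁻¹ • (φ x).1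

/-- The open books `(K, θ)` and `(K', θ')` of the sphere of radius `ε` are equivalent: a
diffeomorphism of the sphere takes `K` onto `K'` and `θ` to `θ'`. -/
def OpenBookEquiv (ε : ℝ) (K : Set (Euc m)) (θ : Euc m → Euc p)
    (K' : Set (Euc m)) (θ' : Euc m → Euc p) : Prop :=
  ∃ Φ : Euc m → Euc m, IsDiffeoOn Φ (sphere 0 ε) (sphere 0 ε) ∧ Φ '' K = K' ∧
    ∀ x ∈ sphere 0 ε \ K, θ' (Φ x) = θ x

/-- The weighted dilation `t · (x₁, …, xₘ) = (t ^ w₁ x₁, …, t ^ wₘ xₘ)`. -/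
def dilate (w : Fin m → ℕ) (t : ℝ) (x : Euc m) : Euc m :=
  WithLp.toLp 2 fun j => t ^ w j * x j

/-- The germ at the origin of `ψ` is a weighted-homogeneous real analytic map germ
`(ℝᵐ, 0) → (ℝᵖ, 0)` of positive weights `w` and positive degree `α`. (For small `x` the point
`t · x` with `0 < t ≤ 1` stays near the origin, so this depends on the germ of `ψ` only.) -/
structure IsWeightedHomogeneousGerm (w : Fin m → ℕ) (α : ℕ) (ψ : Euc m → Euc p) : Prop where
  weight_pos : ∀ j, 0 < w j
  degree_pos : 0 < α
  analytic : AnalyticAt ℝ ψ 0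
  map_zero : ψ 0 = 0
  homogeneous : ∀ᶠ x in 𝓝 (0 : Euc m), ∀ t : ℝ, 0 < t → t ≤ 1 →
    ∀ i, ψ (dilate w t x) i = t ^ α * ψ x i

/-- The singular locus: the points at which the gradients of the components of `ψ` are linearly
dependent. -/
def singularLocus (ψ : Euc m → Euc p) : Set (Euc m) :=
  {x | ¬ LinearIndependent ℝ fun i : Fin p => gradient (fun y => ψ y i) x}

/-- `ψ` has an isolated singularity at the origin: the germ at the origin of its singular locus
is contained in `{0}`. -/
def HasIsolatedSingularity (ψ : Euc m → Euc p) : Prop :=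
  ∀ᶠ x in 𝓝 (0 : Euc m), x ∈ singularLocus ψ → x = 0

/-- The link `K_ε = S_ε ∩ {ψ = 0}`. -/
def link (ψ : Euc m → Euc p) (ε : ℝ) : Set (Euc m) :=
  {x | x ∈ sphere 0 ε ∧ ψ x = 0}

/-- The map `ψ / ‖ψ‖`. -/
noncomputable def normalized (ψ : Euc m → Euc p) (x : Euc m) : Euc p :=
  ‖ψ x‖⁻¹ • ψ x

/-- The vector fields used to inflate the tube `‖ψ‖ = η` in the closed ball of radius `ε` to the
sphere of radius `ε`: smooth on a neighbourhood of the part of the ball where `ψ ≠ 0`, and there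
pointing outwards with respect to both `‖x‖` and `‖ψ‖`. Near the common boundary
`{‖x‖ = ε, ‖ψ‖ = η}` of the tube and of the inflated tube the field is asked to be tangent to the
fibres of `ψ / ‖ψ‖` (that is, its image under `dψ` is a multiple of `ψ`), so that the two parts of
the resulting fibration fit together smoothly. -/
structure IsInflatingField (ψ : Euc m → Euc p) (ε η : ℝ) (v : Euc m → Euc m) : Prop where
  smooth : ∀ᶠ x in 𝓝ˢ (closedBall (0 : Euc m) ε ∩ {x | ψ x ≠ 0}), ContDiffAt ℝ ∞ v x
  outward_ball : ∀ x ∈ closedBall (0 : Euc m) ε, ψ x ≠ 0 → 0 < inner ℝ (v x) x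
  outward_tube : ∀ x ∈ closedBall (0 : Euc m) ε, ψ x ≠ 0 →
    0 < inner ℝ (v x) (gradient (fun y => ‖ψ y‖ ^ 2) x)
  radial : ∀ᶠ x in 𝓝ˢ (sphere (0 : Euc m) ε ∩ {x | ‖ψ x‖ = η}),
    ∃ c : ℝ, fderiv ℝ ψ x (v x) = c • ψ x

/-- The point `y` of the tube `‖ψ‖ = η` in the closed ball of radius `ε` is carried by the field
`v` to the point `x` of the sphere of radius `ε`: an integral curve of `v` within the ball, outside
the open tube, runs from `y` to `x`. -/
def InflatesTo (ψ : Euc m → Euc p) (ε η : ℝ) (v : Euc m → Euc m) (y x : Euc m) : Prop :=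
  ‖ψ y‖ = η ∧ x ∈ sphere 0 ε ∧
    ∃ (a : ℝ) (c : ℝ → Euc m), 0 ≤ a ∧ c 0 = y ∧ c a = x ∧
      ∀ t ∈ Icc 0 a, c t ∈ closedBall 0 ε ∧ η ≤ ‖ψ (c t)‖ ∧
        HasDerivWithinAt c (v (c t)) (Icc 0 a) t

/-- `θ` is Milnor's map `S_ε ∖ K_ε → Sᵖ⁻¹` obtained by inflating the tube `‖ψ‖ = η` along `v`:
it is `ψ / ‖ψ‖` on the part of the sphere where `0 < ‖ψ‖ ≤ η`, and on the rest of the sphere it is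
carried over from the map `ψ / ‖ψ‖` of the tube along the integral curves of `v`. -/
def IsMilnorMap (ψ : Euc m → Euc p) (ε η : ℝ) (v : Euc m → Euc m) (θ : Euc m → Euc p) : Prop :=
  (∀ x ∈ sphere 0 ε \ link ψ ε, ‖ψ x‖ ≤ η → θ x = normalized ψ x) ∧
    ∀ x ∈ sphere 0 ε, η ≤ ‖ψ x‖ → ∃ y, InflatesTo ψ ε η v y x ∧ θ x = normalized ψ y

end HigherOpenBook

/-! Differentiating the homogeneity relation at t = 1 gives Euler's identity dψ(Lx) = αψ(x) for the
linear field L(x) = (w_j x_j), and ⟨Lx, x⟩ > 0 for x ≠ 0. Together with smoothness and the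
surjectivity of dψ away from 0, this is all that the proof uses of ψ (`IsEulerSubmersion`). Lift a
vector c of ℝᵖ by a right inverse of dψ and project along L to the tangent space of the sphere: dψ
of the result is c minus a multiple of ψ (`fderiv_sphereLift`), and a velocity proportional to ψ
does not turn the direction ψ/‖ψ‖.

Spheres are compact, so such fields have global flows, and their time-one maps give explicit
trivializations. Shearing flows bring every direction u with ⟨b, u⟩ > 1/2 to b
(`exists_direction_flow`), which yields local triviality and, as Sᵖ⁻¹ is connected for p ≥ 2,
surjectivity. Near the link the multiple of ψ can be cancelled; the flow then translates the values
of ψ, and a tube about the link becomes a product (`exists_translation_flow`).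

For a Milnor map, the integral curves of an inflating field v define smooth maps A to the tube and B
to the sphere (`exists_tube_sphere_maps`). Interpolating between v and L gives an inflating field v'
that equals v near the corner ‖x‖ = ε, ‖ψ‖ = η and preserves ψ/‖ψ‖ (`exists_radial_field`). The map
Φ that deflates along v and inflates again along v', extended by the identity inside the tube, is a
diffeomorphism of the sphere with (ψ/‖ψ‖) ∘ Φ = θ. So θ is an open book equivalent to ψ/‖ψ‖
(`exists_diffeo_of_isMilnorMap`, `IsOpenBook.transport`).

All of this needs flows that are smooth jointly in time, initial point and parameters
(`exists_isSmoothFlow`), obtained from the implicit function theorem in a Banach space of curves. -/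

namespace HigherOpenBook

/-! ### Superposition operators on spaces of continuous curves. -/

section Superposition

/-- Pointwise application of a continuous family of operators to a continuous curve. -/
noncomputable def pointwiseApply (K : Type*) [TopologicalSpace K] [CompactSpace K]
    (E F : Type*) [NormedAddCommGroup E] [NormedSpace ℝ E] [NormedAddCommGroup F]
    [NormedSpace ℝ F] : C(K, E →L[ℝ] F) →L[ℝ] C(K, E) →L[ℝ] C(K, F) :=
  LinearMap.mkContinuous₂
    (LinearMap.mk₂ ℝ (fun (φ : C(K, E →L[ℝ] F)) (h : C(K, E)) =>
        (⟨fun t => φ t (h t), by fun_prop⟩ : C(K, F)))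
      (fun _ _ _ => by ext; simp) (fun _ _ _ => by ext; simp)
      (fun _ _ _ => by ext; simp) (fun _ _ _ => by ext; simp)) 1 (by
    intro φ h
    rw [ContinuousMap.norm_le _ (by positivity), one_mul]
    intro t
    exact ((φ t).le_opNorm (h t)).trans
      (mul_le_mul (φ.norm_coe_le_norm t) (h.norm_coe_le_norm t) (norm_nonneg _) (norm_nonneg φ)))

variable {K : Type*} [TopologicalSpace K] [CompactSpace K]

@[simp]
theorem pointwiseApply_apply {E F : Type*} [NormedAddCommGroup E] [NormedSpace ℝ E]
    [NormedAddCommGroup F] [NormedSpace ℝ F] (φ : C(K, E →L[ℝ] F)) (h : C(K, E)) (t : K) :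
    pointwiseApply K E F φ h t = φ t (h t) := rfl

/-- The superposition operator `c ↦ f ∘ c` on continuous curves. -/
def superpose {K E F : Type*} [TopologicalSpace K] [TopologicalSpace E] [TopologicalSpace F]
    (f : E → F) (hf : Continuous f) (c : C(K, E)) : C(K, F) :=
  (⟨f, hf⟩ : C(E, F)).comp c

@[simp]
theorem superpose_apply {K E F : Type*} [TopologicalSpace K] [TopologicalSpace E]
    [TopologicalSpace F] (f : E → F) (hf : Continuous f) (c : C(K, E)) (t : K) :
    superpose f hf c t = f (c t) := rfl

/-- Compact support makes `fderiv ℝ f` globally Lipschitz, so the first-order remainder at `c t` is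
at most C‖h t‖², uniformly in t. -/
theorem hasFDerivAt_superpose {E F : Type*} [NormedAddCommGroup E] [NormedSpace ℝ E]
    [NormedAddCommGroup F] [NormedSpace ℝ F]
    {f : E → F} (hf : ContDiff ℝ ∞ f) (hc : HasCompactSupport f) (c : C(K, E)) :
    HasFDerivAt (superpose f hf.continuous : C(K, E) → C(K, F))
      (pointwiseApply K E F (superpose (fderiv ℝ f) (hf.continuous_fderiv (by simp)) c)) c := by
  have h1 : ContDiff ℝ 1 (fderiv ℝ f) := hf.fderiv_right (by norm_cast)
  obtain ⟨C, hC⟩ := h1.lipschitzWith_of_hasCompactSupport (hc.fderiv (𝕜 := ℝ)) (by simp)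
  rw [hasFDerivAt_iff_isLittleO_nhds_zero]
  have key : ∀ h : C(K, E), ‖superpose f hf.continuous (c + h) - superpose f hf.continuous c -
      pointwiseApply K E F (superpose (fderiv ℝ f) (hf.continuous_fderiv (by simp)) c) h‖
      ≤ C * ‖h‖ * ‖h‖ := by
    intro h
    rw [ContinuousMap.norm_le _ (by positivity)]
    intro t
    have := (convex_closedBall (c t) ‖h t‖).norm_image_sub_le_of_norm_hasFDerivWithin_le'
      (f := f) (f' := fun x => fderiv ℝ f x) (φ := fderiv ℝ f (c t)) (C := C * ‖h t‖)
      (x := c t) (y := c t + h t)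
      (fun x _ => (hf.differentiable (by simp) x).hasFDerivAt.hasFDerivWithinAt)
      (fun x hx => by
        rw [← dist_eq_norm]
        exact (hC.dist_le_mul x (c t)).trans
          (mul_le_mul_of_nonneg_left (by simpa using hx) C.2))
      (by simp) (by simp)
    simp only [add_sub_cancel_left] at this
    refine (le_trans ?_ this).trans ?_
    · simp
    · have := h.norm_coe_le_norm t
      gcongr
  refine Asymptotics.IsBigO.trans_isLittleO (g := fun h : C(K, E) => ‖h‖ * ‖h‖) ?_ ?_
  · refine Asymptotics.IsBigO.of_bound C (Eventually.of_forall fun h => ?_)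
    rw [Real.norm_of_nonneg (by positivity), ← mul_assoc]
    exact key h
  · rw [Asymptotics.isLittleO_iff]
    intro δ hδ
    filter_upwards [Metric.ball_mem_nhds (0 : C(K, E)) hδ] with h hh
    rw [Real.norm_of_nonneg (by positivity)]
    exact mul_le_mul_of_nonneg_right (by simpa using hh.le) (norm_nonneg _)

universe u

/-- The derivative is again a superposition operator, by `fderiv ℝ f`, followed by a bounded linear
map; hence the induction on the order. It replaces `F` by `E →L[ℝ] F`, which is why both spaces live
in one universe. -/
theorem contDiff_superpose {E F : Type u} [NormedAddCommGroup E] [NormedSpace ℝ E]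
    [NormedAddCommGroup F] [NormedSpace ℝ F]
    {f : E → F} (hf : ContDiff ℝ ∞ f) (hc : HasCompactSupport f) :
    ContDiff ℝ ∞ (superpose f hf.continuous : C(K, E) → C(K, F)) := by
  rw [contDiff_infty]
  intro n
  induction n generalizing F with
  | zero =>
    rw [Nat.cast_zero, contDiff_zero]
    exact ContinuousMap.continuous_postcomp _
  | succ n ih =>
    rw [Nat.cast_succ, contDiff_succ_iff_hasFDerivAt]
    refine ⟨_, ?_, fun c => hasFDerivAt_superpose hf hc c⟩
    exact (pointwiseApply K E F).contDiff.comp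
      (ih (f := fderiv ℝ f) (hf.fderiv_right (by norm_cast)) (hc.fderiv (𝕜 := ℝ)))

end Superposition

/-! ### Global solutions for bounded Lipschitz fields. -/

section GlobalSolution

variable {E : Type*} [NormedAddCommGroup E] [NormedSpace ℝ E]

/-- A solution of speed at most M stays within M(n + 1) of its start for times up to n + 1, so
Picard–Lindelöf applies on every such interval; uniqueness glues the pieces. -/
theorem exists_global_solution [CompleteSpace E] {X : E → E} {L : NNReal}
    (hL : LipschitzWith L X) {M : ℝ} (hM : ∀ x, ‖X x‖ ≤ M) (x : E) :
    ∃ γ : ℝ → E, γ 0 = x ∧ ∀ t, HasDerivAt γ (X (γ t)) t := by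
  have hM0 : 0 ≤ M := (norm_nonneg _).trans (hM x)
  have hloc : ∀ n : ℕ, ∃ γ : ℝ → E, γ 0 = x ∧
      ∀ t ∈ Ioo (-(n + 1 : ℝ)) (n + 1), HasDerivAt γ (X (γ t)) t := by
    intro n
    have h0 : (0 : ℝ) ∈ Icc (-(n + 1 : ℝ)) (n + 1) := ⟨by linarith [n.cast_nonneg (α := ℝ)], by
      positivity⟩
    have hP : IsPicardLindelof (fun _ : ℝ => X) (⟨0, h0⟩ : Icc (-(n + 1 : ℝ)) (n + 1)) x
        (⟨M * (n + 1), by positivity⟩) 0 ⟨M, hM0⟩ L :=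
      IsPicardLindelof.of_time_independent (fun y _ => hM y) hL.lipschitzOnWith (by
        simp only [sub_zero, zero_sub, neg_neg, max_self, NNReal.coe_zero]; exact le_rfl)
    obtain ⟨γ, hγ0, hγ⟩ := hP.exists_eq_forall_mem_Icc_hasDerivWithinAt₀
    exact ⟨γ, hγ0, fun t ht => (hγ t (Ioo_subset_Icc_self ht)).hasDerivAt (Icc_mem_nhds ht.1 ht.2)⟩
  choose γ hγ0 hγ using hloc
  have hag : ∀ n m : ℕ, n ≤ m → ∀ t ∈ Ioo (-(n + 1 : ℝ)) (n + 1), γ n t = γ m t := by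
    intro n m hnm t ht
    have hnm' : (n : ℝ) ≤ m := by exact_mod_cast hnm
    refine ODE_solution_unique_of_mem_Ioo (v := fun _ => X) (s := fun _ => univ) (K := L)
      (t₀ := 0) (fun _ _ => hL.lipschitzOnWith)
      ⟨by linarith [n.cast_nonneg (α := ℝ)], by positivity⟩
      (fun s hs => ⟨hγ n s hs, trivial⟩)
      (fun s hs => ⟨hγ m s ⟨by linarith [hs.1], by linarith [hs.2]⟩, trivial⟩)
      (by rw [hγ0, hγ0]) ht
  have hmem : ∀ t : ℝ, t ∈ Ioo (-((⌈|t|⌉₊ : ℝ) + 1)) (⌈|t|⌉₊ + 1) := fun t => by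
    rw [mem_Ioo, ← abs_lt]
    linarith [Nat.le_ceil |t|]
  refine ⟨fun t => γ ⌈|t|⌉₊ t, hγ0 _, fun t => ?_⟩
  refine ((hγ _ t (hmem t)).congr_of_eventuallyEq ?_)
  filter_upwards [isOpen_Ioo.mem_nhds (hmem t)] with s hs
  rcases le_total ⌈|s|⌉₊ ⌈|t|⌉₊ with h | h
  · exact hag _ _ h s (hmem s)
  · exact (hag _ _ h s hs).symm

theorem solution_unique {X : E → E} {L : NNReal}
    (hL : LipschitzWith L X) {γ γ' : ℝ → E} (h : ∀ t, HasDerivAt γ (X (γ t)) t)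
    (h' : ∀ t, HasDerivAt γ' (X (γ' t)) t) {t₀ : ℝ} (h0 : γ t₀ = γ' t₀) : γ = γ' :=
  ODE_solution_unique_univ (v := fun _ => X) (s := fun _ => univ) (K := L)
    (fun _ => hL.lipschitzOnWith) (fun t => ⟨h t, trivial⟩) (fun t => ⟨h' t, trivial⟩) h0

end GlobalSolution

/-! ### The integral operator on curves over [0, 1]. -/

section IntegralOperator

/-- A continuous curve on `[0, 1]`, extended to the line by constants. -/
noncomputable def extendCurve {E : Type*} [TopologicalSpace E] (c : C(Icc (0 : ℝ) 1, E))
    (t : ℝ) : E :=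
  c (projIcc 0 1 zero_le_one t)

theorem continuous_extendCurve {E : Type*} [TopologicalSpace E] (c : C(Icc (0 : ℝ) 1, E)) :
    Continuous (extendCurve c) :=
  c.continuous.comp continuous_projIcc

/-- The operator `c ↦ ∫₀ᵗ c` on continuous curves on `[0, 1]`. -/
noncomputable def primitive (E : Type*) [NormedAddCommGroup E] [NormedSpace ℝ E] :
    C(Icc (0 : ℝ) 1, E) →L[ℝ] C(Icc (0 : ℝ) 1, E) :=
  LinearMap.mkContinuous
    { toFun := fun c => ⟨fun t => ∫ s in (0 : ℝ)..t, extendCurve c s,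
        (intervalIntegral.continuous_primitive
          (fun _ _ => (continuous_extendCurve c).intervalIntegrable _ _) 0).comp
          continuous_subtype_val⟩
      map_add' := fun c c' => by
        ext t
        exact intervalIntegral.integral_add ((continuous_extendCurve c).intervalIntegrable _ _)
          ((continuous_extendCurve c').intervalIntegrable _ _)
      map_smul' := fun r c => by
        ext t
        exact intervalIntegral.integral_smul r (extendCurve c) } 1 (by
    intro c
    rw [one_mul, ContinuousMap.norm_le _ (norm_nonneg c)]
    intro t
    refine (intervalIntegral.norm_integral_le_of_norm_le_const (C := ‖c‖)
      fun s _ => c.norm_coe_le_norm _).trans ?_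
    rw [sub_zero, abs_of_nonneg t.2.1]
    exact mul_le_of_le_one_right (norm_nonneg c) t.2.2)

variable {E : Type*} [NormedAddCommGroup E] [NormedSpace ℝ E]

theorem norm_primitive_le : ‖primitive E‖ ≤ 1 :=
  LinearMap.mkContinuous_norm_le _ zero_le_one _

/-- The constant curves. -/
noncomputable def constCurve (E : Type*) [NormedAddCommGroup E] [NormedSpace ℝ E] :
    E →L[ℝ] C(Icc (0 : ℝ) 1, E) :=
  LinearMap.mkContinuous
    { toFun := fun x => ContinuousMap.const _ x
      map_add' := fun _ _ => rfl
      map_smul' := fun _ _ => rfl } 1 (by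
    intro x
    rw [one_mul, ContinuousMap.norm_le _ (norm_nonneg x)]
    intro t
    rfl)

@[simp]
theorem constCurve_apply {E : Type*} [NormedAddCommGroup E] [NormedSpace ℝ E] (x : E)
    (t : Icc (0 : ℝ) 1) : constCurve E x t = x := rfl

end IntegralOperator

/-! ### Smooth dependence of fixed points on parameters. -/

section SmoothFixedPoint

variable {E 𝓒 : Type*} [NormedAddCommGroup E] [NormedSpace ℝ E] [NormedAddCommGroup 𝓒]
  [NormedSpace ℝ 𝓒]

theorem fixedPoint_unique {k : E →L[ℝ] 𝓒} {N : 𝓒 → 𝓒} {L : NNReal} (hL : LipschitzWith L N)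
    {p : ℝ × E} (hp : |p.1| * L < 1) {c c' : 𝓒}
    (h : c = k p.2 + p.1 • N c) (h' : c' = k p.2 + p.1 • N c') : c = c' := by
  have e : c - c' = p.1 • (N c - N c') := by
    conv_lhs => rw [h, h']
    rw [smul_sub]
    abel
  have hn : ‖c - c'‖ ≤ |p.1| * L * ‖c - c'‖ := by
    conv_lhs => rw [e]
    rw [norm_smul, Real.norm_eq_abs, mul_assoc, ← dist_eq_norm, ← dist_eq_norm]
    exact mul_le_mul_of_nonneg_left (hL.dist_le_mul _ _) (abs_nonneg _)
  have : ‖c - c'‖ = 0 := by nlinarith [norm_nonneg (c - c')]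
  exact sub_eq_zero.1 (norm_eq_zero.1 this)

/-- The implicit function theorem applies to c - (k x + s N c): the partial derivative in c is 1 - s
DN, invertible by a Neumann series since |s|L < 1. Uniqueness of the fixed point identifies `sol`
with the implicit function. -/
theorem contDiffAt_fixedPoint [CompleteSpace E] [CompleteSpace 𝓒] {k : E →L[ℝ] 𝓒} {N : 𝓒 → 𝓒}
    {L : NNReal} (hL : LipschitzWith L N) (hN : ContDiff ℝ ∞ N) {sol : ℝ × E → 𝓒}
    (hsol : ∀ p, sol p = k p.2 + p.1 • N (sol p)) {p : ℝ × E} (hp : |p.1| * L < 1) :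
    ContDiffAt ℝ ∞ sol p := by
  set Θ : (ℝ × E) × 𝓒 → 𝓒 := fun q => q.2 - (k q.1.2 + q.1.1 • N q.2) with hΘ
  have hΘs : ContDiff ℝ ∞ Θ := by fun_prop
  set u : (ℝ × E) × 𝓒 := (p, sol p) with hu
  have hΘ0 : Θ u = 0 := sub_eq_zero.2 (hsol p)
  set T : 𝓒 →L[ℝ] 𝓒 := p.1 • fderiv ℝ N (sol p) with hT
  have hder : fderiv ℝ Θ u ∘L .inr ℝ (ℝ × E) 𝓒 = 1 - T := by
    have h1 : HasFDerivAt (fun c => Θ (p, c)) (fderiv ℝ Θ u ∘L .inr ℝ (ℝ × E) 𝓒) (sol p) :=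
      HasFDerivAt.comp (sol p) ((hΘs.differentiable (by simp) u).hasFDerivAt)
        (hasFDerivAt_prodMk_right p (sol p))
    have h2 : HasFDerivAt (fun c => Θ (p, c)) (1 - T) (sol p) :=
      (hasFDerivAt_id (sol p)).fun_sub
        (((hN.differentiable (by simp) (sol p)).hasFDerivAt.fun_const_smul p.1).const_add (k p.2))
    exact h1.unique h2
  have hTn : ‖T‖ < 1 := by
    refine lt_of_le_of_lt ?_ hp
    rw [hT, norm_smul, Real.norm_eq_abs]
    exact mul_le_mul_of_nonneg_left (norm_fderiv_le_of_lipschitz ℝ hL) (abs_nonneg _)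
  have hinv : (fderiv ℝ Θ u ∘L .inr ℝ (ℝ × E) 𝓒).IsInvertible := by
    rw [hder]
    obtain ⟨w, hw⟩ := isUnit_one_sub_of_norm_lt_one hTn
    exact ⟨ContinuousLinearEquiv.unitsEquiv ℝ _ w, by rw [← hw]; rfl⟩
  have hcd : ContDiffAt ℝ ∞ Θ u := hΘs.contDiffAt
  refine (hcd.contDiffAt_implicitFunction (by simp) hinv).congr_of_eventuallyEq ?_
  have hlt : ∀ᶠ q : ℝ × E in 𝓝 p, |q.1| * L < 1 :=
    (((continuous_fst.abs).mul continuous_const).continuousAt (x := p)).eventually_lt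
      continuousAt_const hp
  filter_upwards [hlt, hcd.eventually_apply_implicitFunction (by simp) hinv] with q hq hq'
  refine fixedPoint_unique hL hq (hsol q) ?_
  rw [hΘ0] at hq'
  exact sub_eq_zero.1 hq'

end SmoothFixedPoint

/-! ### Smooth global flows of compactly supported fields. -/

section SmoothFlow

universe u

theorem lipschitzWith_superpose {K E : Type*} [TopologicalSpace K] [CompactSpace K]
    [NormedAddCommGroup E] {X : E → E} {L : NNReal} (hL : LipschitzWith L X) :
    LipschitzWith L (superpose X hL.continuous : C(K, E) → C(K, E)) := by
  refine LipschitzWith.of_dist_le_mul fun c c' => ?_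
  rw [ContinuousMap.dist_le (by positivity)]
  intro t
  exact (hL.dist_le_mul _ _).trans (mul_le_mul_of_nonneg_left (c.dist_apply_le_dist t) L.2)

variable {E : Type u} [NormedAddCommGroup E] [NormedSpace ℝ E]

theorem lipschitzWith_primitive : LipschitzWith 1 (primitive E) := by
  refine LipschitzWith.of_dist_le_mul fun c c' => ?_
  rw [dist_eq_norm, dist_eq_norm, ← map_sub, NNReal.coe_one]
  exact (primitive E).le_of_opNorm_le norm_primitive_le _

/-- A global flow of a vector field, with smooth dependence on time and on the initial point. -/
structure IsSmoothFlow (X : E → E) (F : ℝ × E → E) : Prop where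
  contDiff : ContDiff ℝ ∞ F
  zero : ∀ x, F (0, x) = x
  hasDerivAt : ∀ x t, HasDerivAt (fun s => F (s, x)) (X (F (t, x))) t
  add : ∀ s t x, F (s + t, x) = F (s, F (t, x))
  unique : ∀ γ : ℝ → E, (∀ t, HasDerivAt γ (X (γ t)) t) → ∀ t, γ t = F (t, γ 0)

/-- The integral equation of the flow is a fixed point problem for curves, whence smoothness for
short times; the group law propagates it to all times. -/
theorem exists_isSmoothFlow [CompleteSpace E] {X : E → E} (hX : ContDiff ℝ ∞ X)
    (hc : HasCompactSupport X) : ∃ F, IsSmoothFlow X F := by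
  obtain ⟨L, hL⟩ := hX.lipschitzWith_of_hasCompactSupport hc (by simp)
  obtain ⟨M, hM⟩ := hX.continuous.bounded_above_of_compact_support hc
  choose γ hγ0 hγ using fun x => exists_global_solution hL hM x
  have huniq : ∀ δ : ℝ → E, (∀ t, HasDerivAt δ (X (δ t)) t) → ∀ t, δ t = γ (δ 0) t := by
    intro δ hδ t
    exact congrFun (solution_unique hL hδ (hγ (δ 0)) (t₀ := 0) (hγ0 _).symm) t
  have hadd : ∀ s t x, γ x (s + t) = γ (γ x t) s := by
    intro s t x
    have := huniq (fun s => γ x (s + t)) (fun s => by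
      have := (hγ x (s + t)).scomp s ((hasDerivAt_id s).add_const t)
      simpa [Function.comp_def] using this) s
    simpa using this
  have hcont : ∀ x, Continuous (γ x) := fun x =>
    continuous_iff_continuousAt.2 fun t => (hγ x t).continuousAt
  -- Rescaling time puts all solutions in the same space of curves on [0, 1] and turns the elapsed
  -- time into a parameter of the equation.
  set sol : ℝ × E → C(Icc (0 : ℝ) 1, E) := fun p =>
    ⟨fun τ => γ p.2 (p.1 * τ), (hcont p.2).comp (by fun_prop)⟩ with hsol
  have heq : ∀ p, sol p = constCurve E p.2 +
      p.1 • primitive E (superpose X hL.continuous (sol p)) := by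
    intro p
    ext τ
    change γ p.2 (p.1 * τ) = p.2 + p.1 • ∫ s in (0 : ℝ)..τ,
      extendCurve (superpose X hL.continuous (sol p)) s
    have h1 : ∀ s ∈ uIcc (0 : ℝ) τ, HasDerivAt (fun s => γ p.2 (p.1 * s))
        (p.1 • X (γ p.2 (p.1 * s))) s := fun s _ => by
      have := (hγ p.2 (p.1 * s)).scomp s ((hasDerivAt_id s).const_mul p.1)
      simpa [Function.comp_def] using this
    have h2 := intervalIntegral.integral_eq_sub_of_hasDerivAt h1
      (Continuous.intervalIntegrable (by
        have := hcont p.2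
        have := hL.continuous
        fun_prop) _ _)
    rw [← intervalIntegral.integral_smul]
    have h3 : ∫ s in (0 : ℝ)..τ, p.1 • extendCurve (superpose X hL.continuous (sol p)) s =
        ∫ s in (0 : ℝ)..τ, p.1 • X (γ p.2 (p.1 * s)) := by
      refine intervalIntegral.integral_congr fun s hs => ?_
      rw [uIcc_of_le τ.2.1] at hs
      simp only [extendCurve, superpose_apply, hsol, ContinuousMap.coe_mk,
        projIcc_of_mem zero_le_one (⟨hs.1, hs.2.trans τ.2.2⟩ : s ∈ Icc (0 : ℝ) 1)]
    rw [h3, h2]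
    simp [hγ0]
  have hlip := (lipschitzWith_primitive (E := E)).comp
    (lipschitzWith_superpose (K := Icc (0 : ℝ) 1) hL)
  rw [one_mul] at hlip
  have hsmall : ∀ p : ℝ × E, |p.1| * L < 1 → ContDiffAt ℝ ∞ (fun p : ℝ × E => γ p.2 p.1) p := by
    intro p hp
    have h := contDiffAt_fixedPoint (k := constCurve E) hlip
      ((primitive E).contDiff.comp (contDiff_superpose hX hc)) heq hp
    have h1 := ((ContinuousMap.evalCLM ℝ (⟨1, by simp⟩ : Icc (0 : ℝ) 1)).contDiff
      (n := ∞)).contDiffAt.comp p h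
    refine h1.congr_of_eventuallyEq (Eventually.of_forall fun q => ?_)
    simp [hsol]
  refine ⟨fun p => γ p.2 p.1, ?_, hγ0, fun x t => hγ x t, hadd, huniq⟩
  rw [contDiff_iff_contDiffAt]
  rintro ⟨t, x⟩
  -- With this n, each of the n steps of length t / n is within the range of the short-time result.
  obtain ⟨n, hn⟩ := exists_nat_gt (|t| * L)
  have hn0 : (0 : ℝ) < n := lt_of_le_of_lt (by positivity) hn
  have hstep : ∀ k : ℕ, ContDiffAt ℝ ∞ (fun p : ℝ × E => γ p.2 (k * (p.1 / n))) (t, x) := by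
    intro k
    induction k with
    | zero => simpa [hγ0] using contDiffAt_snd
    | succ k ih =>
      have h1 : ContDiffAt ℝ ∞ (fun p : ℝ × E => (p.1 / (n : ℝ), γ p.2 (k * (p.1 / n)))) (t, x) :=
        (contDiffAt_fst.div_const _).prodMk ih
      have h2 := (hsmall (t / n, γ x (k * (t / n))) (by
        rw [abs_div, abs_of_pos hn0, div_mul_eq_mul_div, div_lt_one hn0]
        exact hn)).comp (t, x) h1
      refine h2.congr_of_eventuallyEq (Eventually.of_forall fun q => ?_)
      simp only [Function.comp_def]
      rw [← hadd]
      congr 1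
      push_cast
      ring
  refine (hstep n).congr_of_eventuallyEq (Eventually.of_forall fun q => ?_)
  simp only
  rw [mul_div_cancel₀ _ hn0.ne']

end SmoothFlow

/-! ### Cutoff functions and localized vector fields. -/

section Cutoff

open scoped Manifold

variable {E F : Type*} [NormedAddCommGroup E] [NormedSpace ℝ E] [FiniteDimensional ℝ E]
  [NormedAddCommGroup F] [NormedSpace ℝ F]

theorem exists_cutoff {Q O : Set E} (hQ : IsCompact Q) (hO : IsOpen O) (hQO : Q ⊆ O) :
    ∃ β : E → ℝ, ContDiff ℝ ∞ β ∧ HasCompactSupport β ∧ tsupport β ⊆ O ∧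
      (∀ᶠ x in 𝓝ˢ Q, β x = 1) ∧ ∀ x, β x ∈ Icc (0 : ℝ) 1 := by
  obtain ⟨K, hK, hQK, hKO⟩ := exists_compact_between hQ hO hQO
  obtain ⟨f, h1, h0, hf⟩ := exists_contMDiffMap_one_nhds_of_subset_interior 𝓘(ℝ, E) (n := ⊤)
    hQ.isClosed hQK
  have hs : Function.support f ⊆ K := fun x hx => by
    by_contra h
    exact hx (h0 x h)
  have hts : tsupport f ⊆ K := closure_minimal hs hK.isClosed
  exact ⟨f, f.contMDiff.contDiff, hK.of_isClosed_subset (isClosed_tsupport _) hts, hts.trans hKO,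
    h1, hf⟩

omit [FiniteDimensional ℝ E] in
theorem contDiff_cutoff_smul {β : E → ℝ} {X : E → F} (hβ : ContDiff ℝ ∞ β)
    (hX : ∀ x ∈ tsupport β, ContDiffAt ℝ ∞ X x) : ContDiff ℝ ∞ fun x => β x • X x := by
  rw [contDiff_iff_contDiffAt]
  intro x
  by_cases hx : x ∈ tsupport β
  · exact hβ.contDiffAt.smul (hX x hx)
  · have h0 := notMem_tsupport_iff_eventuallyEq.1 hx
    refine contDiffAt_const (c := (0 : F)) |>.congr_of_eventuallyEq ?_
    filter_upwards [h0] with y hy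
    simp [hy]

/-- A vector field that is smooth near a compact set agrees near it with the generator of a
global smooth flow. -/
theorem exists_isSmoothFlow_of_compact {Q : Set E} (hQ : IsCompact Q) {X : E → E}
    (hX : ∀ᶠ x in 𝓝ˢ Q, ContDiffAt ℝ ∞ X x) :
    ∃ X' F, IsSmoothFlow X' F ∧ ∀ᶠ x in 𝓝ˢ Q, X' x = X x := by
  obtain ⟨O, hO, hQO, hXO⟩ := mem_nhdsSet_iff_exists.1 hX
  obtain ⟨β, hβ, hβc, hβO, hβ1, -⟩ := exists_cutoff hQ hO hQO
  have : CompleteSpace E := FiniteDimensional.complete ℝ E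
  obtain ⟨F, hF⟩ := exists_isSmoothFlow (contDiff_cutoff_smul hβ fun x hx => hXO (hβO hx))
    (hβc.smul_right (f' := X))
  refine ⟨_, F, hF, ?_⟩
  filter_upwards [hβ1] with x hx
  simp [hx]

end Cutoff

/-! ### Curves whose velocity is a multiple of their position. -/

section LinearODE

/-- The integrating factor exp(-∫μ) makes the curve constant. -/
theorem exists_pos_smul_of_linear_ode {F : Type*} [NormedAddCommGroup F] [NormedSpace ℝ F]
    {u : ℝ → F} {μ : ℝ → ℝ} (hμ : Continuous μ) (hu : ∀ t, HasDerivAt u (μ t • u t) t) (t : ℝ) :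
    ∃ k : ℝ, 0 < k ∧ u t = k • u 0 := by
  set M : ℝ → ℝ := fun t => ∫ s in (0 : ℝ)..t, μ s
  have hM : ∀ t, HasDerivAt M (μ t) t := fun t =>
    intervalIntegral.integral_hasDerivAt_right (hμ.intervalIntegrable _ _)
      (hμ.stronglyMeasurableAtFilter _ _) hμ.continuousAt
  have hw : ∀ t, HasDerivAt (fun t => Real.exp (-M t) • u t) 0 t := fun t => by
    have h := ((hM t).neg.exp).smul (hu t)
    convert! h using 1
    rw [smul_smul, ← add_smul]
    simp
  have hconst := is_const_of_deriv_eq_zero (fun t => (hw t).differentiableAt)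
    (fun t => (hw t).deriv) t 0
  refine ⟨Real.exp (M t), Real.exp_pos _, ?_⟩
  have h0 : M 0 = 0 := by simp [M]
  simp only [h0, neg_zero, Real.exp_zero, one_smul] at hconst
  rw [← hconst, smul_smul, ← Real.exp_add]
  simp

variable {F : Type*} [NormedAddCommGroup F] [InnerProductSpace ℝ F]

theorem contDiffAt_inv_norm_smul {y : F} (hy : y ≠ 0) :
    ContDiffAt ℝ ∞ (fun y : F => ‖y‖⁻¹ • y) y :=
  ((contDiffAt_norm ℝ hy).inv (norm_ne_zero_iff.2 hy)).smul contDiffAt_id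

theorem inv_norm_smul_smul {k : ℝ} (hk : 0 < k) (y : F) : ‖k • y‖⁻¹ • k • y = ‖y‖⁻¹ • y := by
  rw [norm_smul, Real.norm_of_nonneg hk.le, smul_smul, mul_inv, mul_assoc, mul_comm, mul_assoc,
    mul_inv_cancel₀ hk.ne', mul_one]

/-- Normalization is constant along the ray s ↦ s • y, s > 0. -/
theorem fderiv_inv_norm_smul_self {y : F} (hy : y ≠ 0) :
    fderiv ℝ (fun y : F => ‖y‖⁻¹ • y) y y = 0 := by
  have h1 : HasDerivAt (fun s : ℝ => s • y) y 1 := by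
    simpa using (hasDerivAt_id (1 : ℝ)).smul_const y
  have h2 : HasFDerivAt (fun y : F => ‖y‖⁻¹ • y) (fderiv ℝ (fun y : F => ‖y‖⁻¹ • y) y)
      ((1 : ℝ) • y) := by
    rw [one_smul]
    exact ((contDiffAt_inv_norm_smul hy).differentiableAt (by simp)).hasFDerivAt
  have h3 := h2.comp_hasDerivAt 1 h1
  have h4 : HasDerivAt (fun s : ℝ => ‖s • y‖⁻¹ • s • y) 0 1 := by
    refine (hasDerivAt_const (1 : ℝ) (‖y‖⁻¹ • y)).congr_of_eventuallyEq ?_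
    filter_upwards [lt_mem_nhds (zero_lt_one (α := ℝ))] with s hs
    exact inv_norm_smul_smul hs y
  exact h3.unique h4

theorem inv_norm_smul_const_of_radial {u : ℝ → F} {κ : ℝ → ℝ} {a : ℝ}
    (hu : ∀ t ∈ Icc 0 a, HasDerivWithinAt u (κ t • u t) (Icc 0 a) t)
    (h0 : ∀ t ∈ Icc 0 a, u t ≠ 0) {t : ℝ} (ht : t ∈ Icc 0 a) :
    ‖u t‖⁻¹ • u t = ‖u 0‖⁻¹ • u 0 := by
  have hw : ∀ t ∈ Icc 0 a, HasDerivWithinAt (fun t => ‖u t‖⁻¹ • u t) 0 (Icc 0 a) t := by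
    intro t ht
    have h := ((contDiffAt_inv_norm_smul (h0 t ht)).differentiableAt
      (by simp)).hasFDerivAt.comp_hasDerivWithinAt t (hu t ht)
    rwa [map_smul, fderiv_inv_norm_smul_self (h0 t ht), smul_zero] at h
  refine constant_of_derivWithin_zero (fun t ht => (hw t ht).differentiableWithinAt) ?_ t ht
  intro t ht
  have hlt : (0 : ℝ) < a := ht.1.trans_lt ht.2
  exact (hw t ⟨ht.1, ht.2.le⟩).derivWithin (uniqueDiffOn_Icc hlt t ⟨ht.1, ht.2.le⟩)

end LinearODE

/-! ### A right inverse depending smoothly on the operator. -/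

section RightInverse

variable {E F : Type*} [NormedAddCommGroup E] [InnerProductSpace ℝ E] [FiniteDimensional ℝ E]
  [NormedAddCommGroup F] [InnerProductSpace ℝ F] [FiniteDimensional ℝ F]

/-- The Moore–Penrose right inverse of a surjective operator. -/
noncomputable def rightInverse (A : E →L[ℝ] F) : F →L[ℝ] E :=
  have := FiniteDimensional.complete ℝ E
  have := FiniteDimensional.complete ℝ F
  ContinuousLinearMap.adjoint A ∘L (A ∘L ContinuousLinearMap.adjoint A).inverse

omit [FiniteDimensional ℝ E] in
-- If AA*c = 0 then ‖A*c‖² = ⟨AA*c, c⟩ = 0, so c is orthogonal to the range of A, which is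
-- everything.
theorem isInvertible_comp_adjoint [CompleteSpace E] [CompleteSpace F] {A : E →L[ℝ] F}
    (hA : Function.Surjective A) :
    (A ∘L ContinuousLinearMap.adjoint A).IsInvertible := by
  have hinj : Function.Injective (A ∘L ContinuousLinearMap.adjoint A) := by
    rw [injective_iff_map_eq_zero]
    intro c hc
    have h1 : ContinuousLinearMap.adjoint A c = 0 := by
      rw [← inner_self_eq_zero (𝕜 := ℝ), ContinuousLinearMap.adjoint_inner_right]
      rw [ContinuousLinearMap.comp_apply] at hc
      rw [hc, inner_zero_left]
    obtain ⟨h, rfl⟩ := hA c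
    rw [← inner_self_eq_zero (𝕜 := ℝ), ← ContinuousLinearMap.adjoint_inner_left, h1,
      inner_zero_left]
  refine ⟨(LinearEquiv.ofInjectiveEndo (A ∘L ContinuousLinearMap.adjoint A).toLinearMap
    hinj).toContinuousLinearEquiv, ?_⟩
  ext c
  rfl

theorem apply_rightInverse {A : E →L[ℝ] F} (hA : Function.Surjective A) (c : F) :
    A (rightInverse A c) = c := by
  have := FiniteDimensional.complete ℝ E
  have := FiniteDimensional.complete ℝ F
  exact (isInvertible_comp_adjoint hA).self_apply_inverse c

theorem contDiffAt_rightInverse {A : E →L[ℝ] F} (hA : Function.Surjective A) :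
    ContDiffAt ℝ ∞ (rightInverse : (E →L[ℝ] F) → F →L[ℝ] E) A := by
  have := FiniteDimensional.complete ℝ E
  have := FiniteDimensional.complete ℝ F
  have hadj : IsBoundedLinearMap ℝ (fun A : E →L[ℝ] F => ContinuousLinearMap.adjoint A) :=
    ⟨⟨fun _ _ => map_add _ _ _, fun c A => by
      simp⟩, 1, one_pos, fun A => by simp⟩
  have h1 : ContDiff ℝ ∞ (fun A : E →L[ℝ] F => ContinuousLinearMap.adjoint A) := hadj.contDiff
  have h2 : ContDiff ℝ ∞ (fun A : E →L[ℝ] F => A ∘L ContinuousLinearMap.adjoint A) :=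
    contDiff_id.clm_comp h1
  have h3 := ((isInvertible_comp_adjoint hA).contDiffAt_map_inverse (n := ∞)).comp A h2.contDiffAt
  exact h1.contDiffAt.clm_comp h3

end RightInverse

/-! ### Flows on a sphere, depending on a parameter. -/

section SphereFlow

variable {D E : Type} [NormedAddCommGroup D] [NormedSpace ℝ D] [FiniteDimensional ℝ D]
  [NormedAddCommGroup E] [InnerProductSpace ℝ E] [FiniteDimensional ℝ E]

/-- The parameter becomes a coordinate with zero velocity, so the flow on `D × E` is smooth in it.
Multiplying by a cutoff keeps the field tangent to spheres, hence ‖x‖ is conserved; on the compact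
set ‖d‖ ≤ C, ‖x‖ = ε the cutoff is 1 and the flow is that of `Y`. -/
theorem exists_sphere_flow {ε R : ℝ} (C : ℝ) (hε : 0 < ε) (hR : ε < R) {Y : D × E → E}
    (hY : ∀ d x, x ≠ 0 → ‖x‖ < R → ContDiffAt ℝ ∞ Y (d, x))
    (htan : ∀ d x, x ≠ 0 → ‖x‖ < R → inner ℝ x (Y (d, x)) = 0) :
    ∃ G : ℝ × D × E → E, ContDiff ℝ ∞ G ∧ ∀ d, ‖d‖ ≤ C → ∀ x ∈ sphere (0 : E) ε,
      G (0, d, x) = x ∧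
      (∀ t, G (t, d, x) ∈ sphere (0 : E) ε ∧
        HasDerivAt (fun s => G (s, d, x)) (Y (d, G (t, d, x))) t) ∧
      ∀ γ : ℝ → E, γ 0 = x → (∀ t, γ t ∈ sphere (0 : E) ε ∧ HasDerivAt γ (Y (d, γ t)) t) →
        ∀ t, γ t = G (t, d, x) := by
  set O : Set (D × E) := {q | q.2 ≠ 0 ∧ ‖q.2‖ < R} with hOdef
  have hO : IsOpen O := (isOpen_ne.preimage continuous_snd).inter
    (isOpen_lt continuous_snd.norm continuous_const)
  have : ProperSpace D := FiniteDimensional.proper ℝ D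
  have : ProperSpace E := FiniteDimensional.proper ℝ E
  have : CompleteSpace (D × E) := FiniteDimensional.complete ℝ (D × E)
  have hsO : ∀ d, ∀ x ∈ sphere (0 : E) ε, (d, x) ∈ O := fun d x hx => by
    rw [mem_sphere_zero_iff_norm] at hx
    exact ⟨norm_pos_iff.1 (hx ▸ hε), hx ▸ hR⟩
  obtain ⟨β, hβ, hβc, hβO, hβ1, -⟩ := exists_cutoff
    ((isCompact_closedBall (0 : D) C).prod (isCompact_sphere (0 : E) ε)) hO
    (fun q hq => hsO q.1 q.2 hq.2)
  have hβ1' : ∀ d, ‖d‖ ≤ C → ∀ x ∈ sphere (0 : E) ε, β (d, x) = 1 := fun d hd x hx =>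
    hβ1.self_of_nhdsSet (d, x) ⟨by simpa using hd, hx⟩
  obtain ⟨F, hF⟩ := exists_isSmoothFlow
    (contDiff_cutoff_smul (X := fun q : D × E => ((0 : D), Y q)) hβ fun q hq =>
      contDiffAt_const.prodMk (hY q.1 q.2 (hβO hq).1 (hβO hq).2))
    (hβc.smul_right (f' := fun q : D × E => ((0 : D), Y q)))
  have hder1 : ∀ q t, HasDerivAt (fun s => (F (s, q)).1) 0 t := fun q t => by
    have := (hasFDerivAt_fst (𝕜 := ℝ)).comp_hasDerivAt t (hF.hasDerivAt q t)
    rwa [ContinuousLinearMap.coe_fst', Prod.smul_fst, smul_zero] at this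
  have hder2 : ∀ q t, HasDerivAt (fun s => (F (s, q)).2)
      (β (F (t, q)) • Y (F (t, q))) t := fun q t => by
    have := (hasFDerivAt_snd (𝕜 := ℝ)).comp_hasDerivAt t (hF.hasDerivAt q t)
    rwa [ContinuousLinearMap.coe_snd'] at this
  have hfst : ∀ q t, (F (t, q)).1 = q.1 := fun q t => by
    have := is_const_of_deriv_eq_zero (fun t => (hder1 q t).differentiableAt)
      (fun t => (hder1 q t).deriv) t 0
    rw [this, hF.zero]
  have hnorm : ∀ q t, ‖(F (t, q)).2‖ = ‖q.2‖ := fun q t => by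
    have hd : ∀ t, HasDerivAt (fun s => ‖(F (s, q)).2‖ ^ 2) 0 t := fun t => by
      have h := (hder2 q t).norm_sq
      have h0 : inner ℝ (F (t, q)).2 (β (F (t, q)) • Y (F (t, q))) = 0 := by
        by_cases hx : F (t, q) ∈ tsupport β
        · rw [inner_smul_right, htan (F (t, q)).1 _ (hβO hx).1 (hβO hx).2, mul_zero]
        · rw [image_eq_zero_of_notMem_tsupport hx, zero_smul, inner_zero_right]
      rwa [h0, mul_zero] at h
    have := is_const_of_deriv_eq_zero (fun t => (hd t).differentiableAt)
      (fun t => (hd t).deriv) t 0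
    rw [hF.zero] at this
    exact (pow_left_inj₀ (norm_nonneg _) (norm_nonneg _) two_ne_zero).1 this
  refine ⟨fun q => (F q).2, hF.contDiff.snd, fun d hd x hx => ⟨congrArg Prod.snd (hF.zero (d, x)),
    fun t => ?_, fun γ h0 hγ t => ?_⟩⟩
  · have hmem : (F (t, d, x)).2 ∈ sphere (0 : E) ε := by
      rw [mem_sphere_zero_iff_norm] at hx ⊢
      rw [hnorm, hx]
    refine ⟨hmem, ?_⟩
    have h := hder2 (d, x) t
    have e : F (t, d, x) = (d, (F (t, d, x)).2) := Prod.ext (hfst _ _) rfl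
    rw [e, hβ1' d hd _ hmem, one_smul] at h
    exact h
  · have h := hF.unique (fun t => (d, γ t)) (fun t => by
      rw [hβ1' d hd _ (hγ t).1, one_smul]
      exact (hasDerivAt_const t d).prodMk (hγ t).2) t
    rw [h0] at h
    exact congrArg Prod.snd h

end SphereFlow

/-! ### Lifting vectors through the submersion to the tangent spaces of spheres. -/

variable {m p : ℕ}

/-- `ψ` is a smooth submersion on a punctured ball, homogeneous of degree `a` with respect to the
linear vector field `L`, which is transverse to the spheres about the origin. -/
structure IsEulerSubmersion (ψ : Euc m → Euc p) (L : Euc m →L[ℝ] Euc m) (a R : ℝ) : Prop where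
  degree_pos : 0 < a
  smooth : ∀ x, ‖x‖ < R → ContDiffAt ℝ ∞ ψ x
  transverse : ∀ x, x ≠ 0 → 0 < inner ℝ (L x) x
  euler : ∀ x, ‖x‖ < R → fderiv ℝ ψ x (L x) = a • ψ x
  surjective : ∀ x, x ≠ 0 → ‖x‖ < R → Function.Surjective (fderiv ℝ ψ x)

/-- The lift of the vector `c` by the differential of `ψ`, projected along `L` to the tangent
spaces of the spheres. -/
noncomputable def sphereLift (ψ : Euc m → Euc p) (L : Euc m →L[ℝ] Euc m) (q : Euc p × Euc m) :
    Euc m :=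
  rightInverse (fderiv ℝ ψ q.2) q.1 -
    (inner ℝ (rightInverse (fderiv ℝ ψ q.2) q.1) q.2 / inner ℝ (L q.2) q.2) • L q.2

/-- The radial defect of `sphereLift`. -/
noncomputable def sphereSlope (ψ : Euc m → Euc p) (L : Euc m →L[ℝ] Euc m) (a : ℝ)
    (q : Euc p × Euc m) : ℝ :=
  inner ℝ (rightInverse (fderiv ℝ ψ q.2) q.1) q.2 / inner ℝ (L q.2) q.2 * a

namespace IsEulerSubmersion

variable {ψ : Euc m → Euc p} {L : Euc m →L[ℝ] Euc m} {a R : ℝ}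

theorem contDiffAt_fderiv (h : IsEulerSubmersion ψ L a R) {x : Euc m} (hx : ‖x‖ < R) :
    ContDiffAt ℝ ∞ (fderiv ℝ ψ) x :=
  (h.smooth x hx).fderiv_right (by norm_cast)

theorem differentiableAt (h : IsEulerSubmersion ψ L a R) {x : Euc m} (hx : ‖x‖ < R) :
    DifferentiableAt ℝ ψ x :=
  (h.smooth x hx).differentiableAt (by simp)

theorem contDiffAt_rightInverse_apply (h : IsEulerSubmersion ψ L a R) {q : Euc p × Euc m}
    (h0 : q.2 ≠ 0) (hq : ‖q.2‖ < R) :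
    ContDiffAt ℝ ∞ (fun q : Euc p × Euc m => rightInverse (fderiv ℝ ψ q.2) q.1) q := by
  have h1 : ContDiffAt ℝ ∞ (fun q : Euc p × Euc m => fderiv ℝ ψ q.2) q :=
    (h.contDiffAt_fderiv hq).comp q contDiffAt_snd
  have h2 : ContDiffAt ℝ ∞ (fun q : Euc p × Euc m => rightInverse (fderiv ℝ ψ q.2)) q :=
    ContDiffAt.comp (g := rightInverse) q (contDiffAt_rightInverse (h.surjective _ h0 hq)) h1
  exact h2.clm_apply contDiffAt_fst

theorem contDiffAt_quotient (h : IsEulerSubmersion ψ L a R) {q : Euc p × Euc m}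
    (h0 : q.2 ≠ 0) (hq : ‖q.2‖ < R) :
    ContDiffAt ℝ ∞ (fun q : Euc p × Euc m =>
      inner ℝ (rightInverse (fderiv ℝ ψ q.2) q.1) q.2 / inner ℝ (L q.2) q.2) q :=
  ((h.contDiffAt_rightInverse_apply h0 hq).inner ℝ contDiffAt_snd).div
    ((L.contDiff.contDiffAt.comp q contDiffAt_snd).inner ℝ contDiffAt_snd)
    (h.transverse _ h0).ne'

theorem contDiffAt_sphereLift (h : IsEulerSubmersion ψ L a R) {q : Euc p × Euc m}
    (h0 : q.2 ≠ 0) (hq : ‖q.2‖ < R) : ContDiffAt ℝ ∞ (sphereLift ψ L) q :=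
  (h.contDiffAt_rightInverse_apply h0 hq).sub
    ((h.contDiffAt_quotient h0 hq).smul (L.contDiff.contDiffAt.comp q contDiffAt_snd))

theorem contDiffAt_sphereSlope (h : IsEulerSubmersion ψ L a R) {q : Euc p × Euc m}
    (h0 : q.2 ≠ 0) (hq : ‖q.2‖ < R) : ContDiffAt ℝ ∞ (sphereSlope ψ L a) q :=
  (h.contDiffAt_quotient h0 hq).mul contDiffAt_const

theorem inner_sphereLift (h : IsEulerSubmersion ψ L a R) (c : Euc p) {x : Euc m} (h0 : x ≠ 0) :
    inner ℝ x (sphereLift ψ L (c, x)) = 0 := by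
  rw [real_inner_comm, sphereLift, inner_sub_left, real_inner_smul_left,
    div_mul_cancel₀ _ (h.transverse x h0).ne', sub_self]

/-- Euler's identity: removing a multiple of L from the lift changes its image under dψ only by a
multiple of ψ. -/
theorem fderiv_sphereLift (h : IsEulerSubmersion ψ L a R) (c : Euc p) {x : Euc m} (h0 : x ≠ 0)
    (hx : ‖x‖ < R) :
    fderiv ℝ ψ x (sphereLift ψ L (c, x)) = c - sphereSlope ψ L a (c, x) • ψ x := by
  rw [sphereLift, map_sub, map_smul, h.euler x hx, apply_rightInverse (h.surjective x h0 hx),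
    smul_smul]
  rfl

end IsEulerSubmersion

/-- Oddness in c is what lets the time-one map for -c invert the one for c. -/
theorem sphereLift_neg (ψ : Euc m → Euc p) (L : Euc m →L[ℝ] Euc m) (c : Euc p) (x : Euc m) :
    sphereLift ψ L (-c, x) = -sphereLift ψ L (c, x) := by
  simp only [sphereLift, map_neg, inner_neg_left, neg_div, neg_smul]
  abel

theorem sphereSlope_neg (ψ : Euc m → Euc p) (L : Euc m →L[ℝ] Euc m) (a : ℝ) (c : Euc p)
    (x : Euc m) : sphereSlope ψ L a (-c, x) = -sphereSlope ψ L a (c, x) := by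
  simp only [sphereSlope, map_neg, inner_neg_left, neg_div, neg_mul]

/-! ### The link and the open book of ψ/‖ψ‖. -/

namespace IsEulerSubmersion

variable {ψ : Euc m → Euc p} {L : Euc m →L[ℝ] Euc m} {a R ε : ℝ}

theorem ne_zero_of_mem_sphere {E : Type*} [NormedAddCommGroup E] {x : E} (hε : 0 < ε)
    (hx : x ∈ sphere (0 : E) ε) : x ≠ 0 := by
  rw [mem_sphere_zero_iff_norm] at hx
  exact norm_pos_iff.1 (hx ▸ hε)

theorem norm_lt_of_mem_sphere {E : Type*} [NormedAddCommGroup E] {x : E} (hR : ε < R)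
    (hx : x ∈ sphere (0 : E) ε) : ‖x‖ < R := by
  rw [mem_sphere_zero_iff_norm] at hx
  rwa [hx]

theorem continuousOn_sphere (h : IsEulerSubmersion ψ L a R) (hR : ε < R) :
    ContinuousOn ψ (sphere 0 ε) := fun x hx =>
  (h.smooth x (norm_lt_of_mem_sphere hR hx)).continuousAt.continuousWithinAt

theorem isClosed_link (h : IsEulerSubmersion ψ L a R) (hR : ε < R) : IsClosed (link ψ ε) :=
  (h.continuousOn_sphere hR).preimage_isClosed_of_isClosed isClosed_sphere isClosed_singleton

/-- The error term of `sphereLift` is a multiple of ψ, so on the link the lift is exact and shows ψ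
to be a submersion of the sphere. -/
theorem isSubmanifoldOfSphere_link (h : IsEulerSubmersion ψ L a R) (hε : 0 < ε) (hR : ε < R) :
    IsSubmanifoldOfSphere p ε (link ψ ε) := by
  refine ⟨h.isClosed_link hR, fun x hx => hx.1, fun x hx => ⟨ball 0 R, isOpen_ball, ?_, ψ, ?_, ?_,
    ?_⟩⟩
  · simpa using norm_lt_of_mem_sphere hR hx.1
  · exact fun y hy => (h.smooth y (by simpa using hy)).contDiffWithinAt
  · ext y
    simp only [link, mem_inter_iff, mem_ofPred_eq]
    tauto
  · rintro y ⟨⟨hy, hy0⟩, -⟩ c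
    refine ⟨sphereLift ψ L (c, y), h.inner_sphereLift c (ne_zero_of_mem_sphere hε hy), ?_⟩
    rw [h.fderiv_sphereLift c (ne_zero_of_mem_sphere hε hy) (norm_lt_of_mem_sphere hR hy), hy0,
      smul_zero, sub_zero]

/-- Running a sphere flow whose field is odd in the parameter backwards. -/
theorem sphere_flow_reverse {D E : Type} [NormedAddCommGroup D] [NormedSpace ℝ D]
    [NormedAddCommGroup E] [NormedSpace ℝ E] {C : ℝ} {Y : D × E → E}
    (hodd : ∀ d, ∀ x ∈ sphere (0 : E) ε, Y (-d, x) = -Y (d, x)) {G : ℝ × D × E → E}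
    (hG : ∀ d, ‖d‖ ≤ C → ∀ x ∈ sphere (0 : E) ε,
      G (0, d, x) = x ∧
      (∀ t, G (t, d, x) ∈ sphere (0 : E) ε ∧
        HasDerivAt (fun s => G (s, d, x)) (Y (d, G (t, d, x))) t) ∧
      ∀ γ : ℝ → E, γ 0 = x → (∀ t, γ t ∈ sphere (0 : E) ε ∧ HasDerivAt γ (Y (d, γ t)) t) →
        ∀ t, γ t = G (t, d, x))
    {d : D} (hd : ‖d‖ ≤ C) {x : E} (hx : x ∈ sphere (0 : E) ε) :
    G (1, -d, G (1, d, x)) = x := by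
  obtain ⟨h0, h1, -⟩ := hG d hd x hx
  have h := (hG (-d) (by rwa [norm_neg]) _ (h1 1).1).2.2 (fun t => G (1 - t, d, x)) (by simp)
    (fun t => ⟨(h1 _).1, by
      rw [hodd d _ (h1 _).1]
      have := (h1 (1 - t)).2.scomp t ((hasDerivAt_id t).const_sub 1)
      simpa [Function.comp_def] using this⟩) 1
  rw [← h, sub_self, h0]

theorem hasDerivAt_comp_sphere (h : IsEulerSubmersion ψ L a R) (hR : ε < R) {γ : ℝ → Euc m}
    {v : Euc m} {t : ℝ} (hγ : γ t ∈ sphere (0 : Euc m) ε) (hv : HasDerivAt γ v t) :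
    HasDerivAt (fun s => ψ (γ s)) (fderiv ℝ ψ (γ t) v) t :=
  (h.differentiableAt (norm_lt_of_mem_sphere hR hγ)).hasFDerivAt.comp_hasDerivAt t hv

theorem continuous_sphereSlope_comp (h : IsEulerSubmersion ψ L a R) (hε : 0 < ε) (hR : ε < R)
    (d : Euc p) {γ : ℝ → Euc m} (hγ : ∀ t, γ t ∈ sphere (0 : Euc m) ε) (hc : Continuous γ) :
    Continuous fun t => sphereSlope ψ L a (d, γ t) := by
  rw [continuous_iff_continuousAt]
  intro t
  exact ContinuousAt.comp (g := sphereSlope ψ L a) (f := fun t => (d, γ t))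
    (h.contDiffAt_sphereSlope (q := (d, γ t)) (ne_zero_of_mem_sphere hε (hγ t))
      (norm_lt_of_mem_sphere hR (hγ t))).continuousAt (by fun_prop)

/-- Along the field ⟨b, ψ⟩ times the lift of d, ψ' = f d + μψ with f = ⟨b, ψ⟩. If d ⊥ b then f' =
μf, so ψ - t f d solves u' = μu and at time 1 is a positive multiple k of ψ(x). Pairing with b gives
f(1) = k⟨b, ψ(x)⟩. -/
theorem exists_shear_flow (h : IsEulerSubmersion ψ L a R) (hε : 0 < ε) (hR : ε < R)
    (b : Euc p) (C : ℝ) :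
    ∃ G : ℝ × Euc p × Euc m → Euc m, ContDiff ℝ ∞ G ∧ ∀ d, ‖d‖ ≤ C → ∀ x ∈ sphere (0 : Euc m) ε,
      G (1, d, x) ∈ sphere (0 : Euc m) ε ∧ G (1, -d, G (1, d, x)) = x ∧
      (inner ℝ b d = 0 →
        ∃ k : ℝ, 0 < k ∧ ψ (G (1, d, x)) = k • (ψ x + inner ℝ b (ψ x) • d)) := by
  obtain ⟨G, hGs, hG⟩ := exists_sphere_flow (D := Euc p) C hε hR
    (Y := fun q => inner ℝ b (ψ q.2) • sphereLift ψ L q)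
    (fun d x h0 hx => (contDiffAt_const.inner ℝ ((h.smooth x hx).comp (d, x) contDiffAt_snd)).smul
      (h.contDiffAt_sphereLift (q := (d, x)) h0 hx))
    (fun d x h0 hx => by rw [inner_smul_right, h.inner_sphereLift d h0, mul_zero])
  refine ⟨G, hGs, fun d hd x hx => ⟨((hG d hd x hx).2.1 1).1, ?_, fun hbd => ?_⟩⟩
  · exact sphere_flow_reverse (Y := fun q => inner ℝ b (ψ q.2) • sphereLift ψ L q)
      (fun d x _ => by simp only [sphereLift_neg, smul_neg]) hG hd hx
  · obtain ⟨h0, h1, -⟩ := hG d hd x hx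
    set γ : ℝ → Euc m := fun t => G (t, d, x) with hγ
    have hγS : ∀ t, γ t ∈ sphere (0 : Euc m) ε := fun t => (h1 t).1
    have hγc : Continuous γ := continuous_iff_continuousAt.2 fun t => (h1 t).2.continuousAt
    set f : ℝ → ℝ := fun t => inner ℝ b (ψ (γ t)) with hf
    set μ : ℝ → ℝ := fun t => -(f t * sphereSlope ψ L a (d, γ t)) with hμ
    have hψ : ∀ t, HasDerivAt (fun s => ψ (γ s)) (f t • d + μ t • ψ (γ t)) t := fun t => by
      have := h.hasDerivAt_comp_sphere hR (hγS t) (h1 t).2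
      rw [map_smul, h.fderiv_sphereLift d (ne_zero_of_mem_sphere hε (hγS t))
        (norm_lt_of_mem_sphere hR (hγS t))] at this
      convert! this using 1
      rw [hμ, smul_sub, smul_smul, neg_smul, sub_eq_add_neg]
    have hψc : Continuous fun t => ψ (γ t) :=
      continuous_iff_continuousAt.2 fun t => (hψ t).continuousAt
    have hfd : ∀ t, HasDerivAt f (μ t * f t) t := fun t => by
      have := (hasDerivAt_const t b).inner ℝ (hψ t)
      simpa [inner_add_right, inner_smul_right, hbd] using this
    have hμc : Continuous μ :=
      ((continuous_const.inner hψc).mul (h.continuous_sphereSlope_comp hε hR d hγS hγc)).neg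
    have hu : ∀ t, HasDerivAt (fun t => ψ (γ t) - (t * f t) • d)
        (μ t • (ψ (γ t) - (t * f t) • d)) t := fun t => by
      have := (hψ t).sub (((hasDerivAt_id t).mul (hfd t)).smul_const d)
      convert! this using 1
      simp only [id, one_mul, smul_sub, add_smul, smul_smul]
      rw [show μ t * (t * f t) = t * (μ t * f t) by ring]
      abel
    obtain ⟨k, hk, hk1⟩ := exists_pos_smul_of_linear_ode hμc hu 1
    refine ⟨k, hk, ?_⟩
    have hγ0 : γ 0 = x := h0
    simp only [one_mul, zero_mul, zero_smul, sub_zero, hγ0] at hk1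
    have hf1 : f 1 = k * inner ℝ b (ψ x) := by
      have := congrArg (fun z => inner ℝ b z) hk1
      simpa [inner_sub_right, inner_smul_right, hbd, hf] using this
    rw [hf1, sub_eq_iff_eq_add] at hk1
    rw [smul_add, smul_smul]
    exact hk1

/-- The shear direction carrying the unit vector `u` to the direction of `b`. -/
noncomputable def shear {p : ℕ} (b u : Euc p) : Euc p := b - (inner ℝ b u)⁻¹ • u

theorem inner_shear {b u : Euc p} (hb : b ∈ sphere (0 : Euc p) 1) (hu : 1 / 2 < inner ℝ b u) :
    inner ℝ b (shear b u) = 0 := by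
  have : (inner ℝ b u : ℝ) ≠ 0 := by positivity
  rw [mem_sphere_zero_iff_norm] at hb
  rw [shear, inner_sub_right, inner_smul_right, real_inner_self_eq_norm_sq, hb,
    inv_mul_cancel₀ this]
  norm_num

theorem norm_shear_le {b u : Euc p} (hb : b ∈ sphere (0 : Euc p) 1)
    (hu : u ∈ sphere (0 : Euc p) 1) (hbu : 1 / 2 < inner ℝ b u) : ‖shear b u‖ ≤ 3 := by
  rw [mem_sphere_zero_iff_norm] at hb hu
  refine (norm_sub_le _ _).trans ?_
  rw [norm_smul, hb, hu, mul_one, norm_inv, Real.norm_of_nonneg (by linarith)]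
  have := inv_anti₀ (by norm_num) hbu.le
  norm_num at this ⊢
  linarith

theorem contDiffAt_shear {b u : Euc p} (hbu : 1 / 2 < inner ℝ b u) :
    ContDiffAt ℝ ∞ (shear b) u :=
  contDiffAt_const.sub (((contDiffAt_const.inner ℝ contDiffAt_id).inv
    (by simp only [id]; positivity)).smul contDiffAt_id)

theorem normalized_mem_sphere {x : Euc m} (hx : ψ x ≠ 0) :
    normalized ψ x ∈ sphere (0 : Euc p) 1 := by
  rw [mem_sphere_zero_iff_norm, normalized, norm_smul, norm_inv, norm_norm,
    inv_mul_cancel₀ (norm_ne_zero_iff.2 hx)]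

theorem contDiffAt_normalized (h : IsEulerSubmersion ψ L a R) {x : Euc m} (hR : ‖x‖ < R)
    (hx : ψ x ≠ 0) : ContDiffAt ℝ ∞ (normalized ψ) x :=
  ContDiffAt.comp (g := fun y : Euc p => ‖y‖⁻¹ • y) x (contDiffAt_inv_norm_smul hx)
    (h.smooth x hR)

theorem ne_zero_of_mem_diff_link {x : Euc m} (hx : x ∈ sphere 0 ε \ link ψ ε) : ψ x ≠ 0 :=
  fun h0 => hx.2 ⟨hx.1, h0⟩

/-- The shear vector d = b - u/⟨b, u⟩ is orthogonal to b and satisfies u + ⟨b, u⟩d = ⟨b, u⟩b and b -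
d = u/⟨b, u⟩: the shear by d turns direction u into b, and the shear by -d turns b into u. -/
theorem exists_direction_flow (h : IsEulerSubmersion ψ L a R) (hε : 0 < ε) (hR : ε < R)
    {b : Euc p} (hb : b ∈ sphere (0 : Euc p) 1) :
    ∃ G : ℝ × Euc p × Euc m → Euc m, ContDiff ℝ ∞ G ∧
      (∀ x ∈ sphere 0 ε \ link ψ ε, 1 / 2 < inner ℝ b (normalized ψ x) →
        G (1, shear b (normalized ψ x), x) ∈ sphere 0 ε \ link ψ ε ∧
        normalized ψ (G (1, shear b (normalized ψ x), x)) = b ∧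
        G (1, -shear b (normalized ψ x), G (1, shear b (normalized ψ x), x)) = x) ∧
      ∀ y ∈ sphere 0 ε \ link ψ ε, normalized ψ y = b → ∀ u ∈ sphere (0 : Euc p) 1,
        1 / 2 < inner ℝ b u →
        G (1, -shear b u, y) ∈ sphere 0 ε \ link ψ ε ∧ normalized ψ (G (1, -shear b u, y)) = u ∧
        G (1, shear b u, G (1, -shear b u, y)) = y := by
  have hb1 : ‖b‖ = 1 := mem_sphere_zero_iff_norm.1 hb
  -- 3 = 1 + 2 bounds the shear vectors, because ⟨b, u⟩⁻¹ < 2.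
  obtain ⟨G, hGs, hG⟩ := h.exists_shear_flow hε hR b 3
  have key : ∀ z ∈ sphere (0 : Euc m) ε, ∀ k : ℝ, 0 < k → ∀ w ∈ sphere (0 : Euc p) 1,
      ψ z = k • w → z ∈ sphere 0 ε \ link ψ ε ∧ normalized ψ z = w := by
    intro z hz k hk w hw hzw
    have hw1 : ‖w‖ = 1 := mem_sphere_zero_iff_norm.1 hw
    refine ⟨⟨hz, fun hz' => ?_⟩, ?_⟩
    · have := hz'.2
      rw [hzw, smul_eq_zero] at this
      exact this.elim hk.ne' (fun h => by simp [h] at hw1)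
    · rw [normalized, hzw, inv_norm_smul_smul hk, hw1, inv_one, one_smul]
  refine ⟨G, hGs, fun x hx hu => ?_, fun y hy hyb u hu hbu => ?_⟩
  · have hx0 := ne_zero_of_mem_diff_link hx
    have hn := norm_shear_le hb (normalized_mem_sphere hx0) hu
    obtain ⟨h1, h2, h3⟩ := hG _ hn x hx.1
    obtain ⟨k, hk, hk1⟩ := h3 (inner_shear hb hu)
    have hpos : 0 < ‖ψ x‖ := norm_pos_iff.2 hx0
    have e : inner ℝ b (ψ x) = ‖ψ x‖ * inner ℝ b (normalized ψ x) := by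
      rw [normalized, inner_smul_right, mul_inv_cancel_left₀ hpos.ne']
    have hne : (inner ℝ b (normalized ψ x) : ℝ) ≠ 0 := by positivity
    have e2 : ψ x = ‖ψ x‖ • normalized ψ x := by
      rw [normalized, smul_inv_smul₀ hpos.ne']
    have := key _ h1 (k * inner ℝ b (ψ x)) (by rw [e]; positivity) b hb (by
      rw [hk1, mul_smul]
      congr 1
      rw [shear, smul_sub, smul_smul]
      conv_lhs => rw [e, mul_assoc, mul_inv_cancel₀ hne, mul_one, ← e2]
      rw [e]
      abel)
    exact ⟨this.1, this.2, h2⟩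
  · have hy0 := ne_zero_of_mem_diff_link hy
    have hn := norm_shear_le hb hu hbu
    have hpos : 0 < ‖ψ y‖ := norm_pos_iff.2 hy0
    obtain ⟨h1, h2, h3⟩ := hG (-shear b u) (by rwa [norm_neg]) y hy.1
    obtain ⟨k, hk, hk1⟩ := h3 (by rw [inner_neg_right, inner_shear hb hbu, neg_zero])
    rw [neg_neg] at h2
    have e2 : ψ y = ‖ψ y‖ • b := by
      rw [← hyb, normalized, smul_inv_smul₀ hpos.ne']
    have e3 : inner ℝ b (ψ y) = ‖ψ y‖ := by
      rw [e2, inner_smul_right, real_inner_self_eq_norm_sq, hb1, norm_smul, hb1]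
      simp
    have := key _ h1 (k * ‖ψ y‖ * (inner ℝ b u)⁻¹) (by positivity) u hu (by
      rw [hk1, e3, mul_assoc, mul_smul, mul_smul]
      congr 1
      nth_rewrite 1 [e2]
      rw [← smul_add, shear]
      congr 1
      abel)
    exact ⟨this.1, this.2, h2⟩

/-- If ψ vanished on the whole sphere, it would be constant along the flow of the lift of some c ≠
0, although its derivative there is c. -/
theorem nonempty_diff_link (h : IsEulerSubmersion ψ L a R) (hε : 0 < ε) (hR : ε < R)
    (hm : 0 < m) (hp : 0 < p) : (sphere 0 ε \ link ψ ε).Nonempty := by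
  have : Nonempty (Fin m) := ⟨⟨0, hm⟩⟩
  have : Nonempty (Fin p) := ⟨⟨0, hp⟩⟩
  obtain ⟨x, hx⟩ := NormedSpace.sphere_nonempty (x := (0 : Euc m)) |>.2 hε.le
  by_contra hne
  rw [not_nonempty_iff_eq_empty, sdiff_eq_empty] at hne
  obtain ⟨c, hc⟩ := exists_ne (0 : Euc p)
  obtain ⟨G, -, hG⟩ := exists_sphere_flow (D := Euc p) ‖c‖ hε hR (Y := sphereLift ψ L)
    (fun d x h0 hx => h.contDiffAt_sphereLift (q := (d, x)) h0 hx)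
    (fun d x h0 hx => h.inner_sphereLift d h0)
  obtain ⟨h0, h1, -⟩ := hG c le_rfl x hx
  have hz : ∀ t, ψ (G (t, c, x)) = 0 := fun t => (hne (h1 t).1).2
  have h2 := h.hasDerivAt_comp_sphere (γ := fun s => G (s, c, x)) (t := 0) hR (h1 0).1 (h1 0).2
  rw [h.fderiv_sphereLift c (ne_zero_of_mem_sphere hε (h1 0).1)
    (norm_lt_of_mem_sphere hR (h1 0).1), hz, smul_zero, sub_zero] at h2
  have h3 : HasDerivAt (fun s => ψ (G (s, c, x))) 0 0 := by
    simp only [hz]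
    exact hasDerivAt_const _ _
  exact hc (h2.unique h3)

/-- When ⟨b, u⟩ > 1/2, b is a value if and only if u is. So the image and its complement in the
sphere are both relatively open, and the sphere is connected. -/
theorem surjOn_normalized (h : IsEulerSubmersion ψ L a R) (hε : 0 < ε) (hR : ε < R)
    (hm : 0 < m) (hp : 2 ≤ p) :
    SurjOn (normalized ψ) (sphere 0 ε \ link ψ ε) (sphere 0 1) := by
  set I := normalized ψ '' (sphere 0 ε \ link ψ ε) with hI
  have hstep : ∀ b ∈ sphere (0 : Euc p) 1, ∀ u ∈ sphere (0 : Euc p) 1, 1 / 2 < inner ℝ b u →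
      b ∈ I → u ∈ I := by
    rintro b hb u hu hbu ⟨y, hy, rfl⟩
    obtain ⟨G, -, -, hG⟩ := h.exists_direction_flow hε hR hb
    obtain ⟨h1, h2, -⟩ := hG y hy rfl u hu hbu
    exact ⟨_, h1, h2⟩
  have hIS : I ⊆ sphere 0 1 := by
    rintro _ ⟨x, hx, rfl⟩
    exact normalized_mem_sphere (ne_zero_of_mem_diff_link hx)
  have hopen : ∀ T : Set (Euc p), IsOpen {v : Euc p | ∃ b ∈ T, 1 / 2 < inner ℝ b v} := by
    intro T
    have : {v : Euc p | ∃ b ∈ T, 1 / 2 < inner ℝ b v} =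
        ⋃ b ∈ T, {v : Euc p | (1 / 2 : ℝ) < inner ℝ b v} := by
      ext v
      simp
    rw [this]
    exact isOpen_biUnion fun b _ => isOpen_lt continuous_const (by fun_prop)
  have hself : ∀ b ∈ sphere (0 : Euc p) 1, (1 / 2 : ℝ) < inner ℝ b b := by
    intro b hb
    rw [real_inner_self_eq_norm_sq, mem_sphere_zero_iff_norm.1 hb]
    norm_num
  have hconn : IsPreconnected (sphere (0 : Euc p) 1) := isPreconnected_sphere (by
    rw [← Module.finrank_eq_rank, finrank_euclideanSpace_fin]
    exact_mod_cast hp) 0 1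
  intro u hu
  by_contra hu'
  obtain ⟨x, hx⟩ := h.nonempty_diff_link hε hR hm (by omega)
  have hxI : normalized ψ x ∈ I := ⟨x, hx, rfl⟩
  obtain ⟨v, hv, ⟨b, hb, hbv⟩, ⟨b', hb', hbv'⟩⟩ := hconn _ _ (hopen I) (hopen (sphere 0 1 \ I))
    (fun v hv => by
      by_cases hvI : v ∈ I
      · exact Or.inl ⟨v, hvI, hself v hv⟩
      · exact Or.inr ⟨v, ⟨hv, hvI⟩, hself v hv⟩)
    ⟨_, hIS hxI, _, hxI, hself _ (hIS hxI)⟩ ⟨u, hu, u, ⟨hu, hu'⟩, hself u hu⟩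
  exact hb'.2 (hstep v hv b' hb'.1 (by rwa [real_inner_comm])
    (hstep b (hIS hb) v hv hbv hb))

theorem isSmoothFibration_normalized (h : IsEulerSubmersion ψ L a R) (hε : 0 < ε) (hR : ε < R)
    (hm : 0 < m) (hp : 2 ≤ p) :
    IsSmoothFibration (normalized ψ) (sphere 0 ε \ link ψ ε) (sphere 0 1) := by
  have hsm : ∀ x ∈ sphere 0 ε \ link ψ ε, ContDiffAt ℝ ∞ (normalized ψ) x := fun x hx =>
    h.contDiffAt_normalized (norm_lt_of_mem_sphere hR hx.1) (ne_zero_of_mem_diff_link hx)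
  have hmaps : MapsTo (normalized ψ) (sphere 0 ε \ link ψ ε) (sphere 0 1) := fun x hx =>
    normalized_mem_sphere (ne_zero_of_mem_diff_link hx)
  refine ⟨fun x hx => (hsm x hx).contDiffWithinAt, hmaps, h.surjOn_normalized hε hR hm hp,
    fun b hb => ?_⟩
  obtain ⟨G, hGs, hG1, hG2⟩ := h.exists_direction_flow hε hR hb
  refine ⟨{u | 1 / 2 < inner ℝ b u}, isOpen_lt continuous_const (by fun_prop), ?_,
    fun x => (normalized ψ x, G (1, shear b (normalized ψ x), x)), ⟨?_, ?_,
      fun q => G (1, -shear b q.1, q.2), ?_, ?_, ?_, ?_⟩, fun x _ => rfl⟩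
  · rw [mem_ofPred_eq, real_inner_self_eq_norm_sq, mem_sphere_zero_iff_norm.1 hb]
    norm_num
  · rintro x ⟨hx, hxu⟩
    have h1 : ContDiffAt ℝ ∞ (fun x => shear b (normalized ψ x)) x :=
      ContDiffAt.comp (g := shear b) x (contDiffAt_shear hxu) (hsm x hx)
    exact ((hsm x hx).prodMk (hGs.contDiffAt.comp x
      (contDiffAt_const.prodMk (h1.prodMk contDiffAt_id)))).contDiffWithinAt
  · rintro x ⟨hx, hxu⟩
    obtain ⟨h1, h2, h3⟩ := hG1 x hx hxu
    exact ⟨⟨hmaps hx, hxu⟩, h1, h2⟩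
  · rintro ⟨u, y⟩ ⟨⟨hu, hbu⟩, -⟩
    have h1 : ContDiffAt ℝ ∞ (fun q : Euc p × Euc m => shear b q.1) (u, y) :=
      ContDiffAt.comp (g := shear b) (u, y) (contDiffAt_shear hbu) contDiffAt_fst
    exact (hGs.contDiffAt.comp (u, y)
      (contDiffAt_const.prodMk (h1.neg.prodMk contDiffAt_snd))).contDiffWithinAt
  · rintro ⟨u, y⟩ ⟨⟨hu, hbu⟩, hy, hyb⟩
    obtain ⟨h1, h2, h3⟩ := hG2 y hy hyb u hu hbu
    refine ⟨h1, ?_⟩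
    rw [mem_preimage, h2]
    exact hbu
  · rintro x ⟨hx, hxu⟩
    exact (hG1 x hx hxu).2.2
  · rintro ⟨u, y⟩ ⟨⟨hu, hbu⟩, hy, hyb⟩
    obtain ⟨h1, h2, h3⟩ := hG2 y hy hyb u hu hbu
    simp only [h2, h3]

theorem contDiffAt_selfSlope (h : IsEulerSubmersion ψ L a R) {x : Euc m} (h0 : x ≠ 0)
    (hx : ‖x‖ < R) : ContDiffAt ℝ ∞ (fun x => sphereSlope ψ L a (ψ x, x)) x :=
  ContDiffAt.comp (g := sphereSlope ψ L a) (f := fun x => (ψ x, x)) x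
    (h.contDiffAt_sphereSlope (q := (ψ x, x)) h0 hx) ((h.smooth x hx).prodMk contDiffAt_id)

/-- The slope of ψ(x) at x vanishes where ψ does, so the compact set where it is at least 1 misses
the link, and ‖ψ‖ has a positive minimum on it. -/
theorem exists_tube_slope_lt_one (h : IsEulerSubmersion ψ L a R) (hε : 0 < ε) (hR : ε < R) :
    ∃ δ : ℝ, 0 < δ ∧ ∀ x ∈ sphere (0 : Euc m) ε, ‖ψ x‖ ≤ δ → sphereSlope ψ L a (ψ x, x) < 1 := by
  set Z : Set (Euc m) := sphere 0 ε ∩ (fun x => sphereSlope ψ L a (ψ x, x)) ⁻¹' Ici 1 with hZ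
  have hs : ContinuousOn (fun x => sphereSlope ψ L a (ψ x, x)) (sphere (0 : Euc m) ε) :=
    fun x hx => (h.contDiffAt_selfSlope (ne_zero_of_mem_sphere hε hx)
      (norm_lt_of_mem_sphere hR hx)).continuousAt.continuousWithinAt
  have hZc : IsCompact Z := (isCompact_sphere (0 : Euc m) ε).of_isClosed_subset
    (hs.preimage_isClosed_of_isClosed isClosed_sphere isClosed_Ici) inter_subset_left
  have hψZ : ContinuousOn (fun x => ‖ψ x‖) Z :=
    ((h.continuousOn_sphere hR).mono inter_subset_left).norm
  rcases Z.eq_empty_or_nonempty with hE | hne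
  · refine ⟨1, one_pos, fun x hx _ => ?_⟩
    by_contra hlt
    have : x ∈ Z := ⟨hx, not_lt.1 hlt⟩
    rw [hE] at this
    exact this
  · obtain ⟨z, hz, hmin⟩ := hZc.exists_isMinOn hne hψZ
    have hz0 : 0 < ‖ψ z‖ := by
      rw [norm_pos_iff]
      intro h0
      have h1 : (1 : ℝ) ≤ sphereSlope ψ L a (ψ z, z) := hz.2
      rw [h0] at h1
      simp [sphereSlope] at h1
      linarith
    refine ⟨‖ψ z‖ / 2, half_pos hz0, fun x hx hxd => ?_⟩
    by_contra hlt
    have : ‖ψ z‖ ≤ ‖ψ x‖ := hmin (show x ∈ Z from ⟨hx, not_lt.1 hlt⟩)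
    linarith

/-- The field whose flow moves the value of `ψ` with constant velocity near the link. -/
noncomputable def exactLift (ψ : Euc m → Euc p) (L : Euc m →L[ℝ] Euc m) (a : ℝ)
    (q : Euc p × Euc m) : Euc m :=
  sphereLift ψ L q +
    (sphereSlope ψ L a q / (1 - sphereSlope ψ L a (ψ q.2, q.2))) • sphereLift ψ L (ψ q.2, q.2)

/-- dψ sends the lift of ψ(x) itself to (1 - s)ψ(x), s being its slope; after division by 1 - s this
cancels the error of the lift of c. -/
theorem fderiv_exactLift (h : IsEulerSubmersion ψ L a R) (c : Euc p) {x : Euc m} (h0 : x ≠ 0)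
    (hx : ‖x‖ < R) (hs : sphereSlope ψ L a (ψ x, x) < 1) :
    fderiv ℝ ψ x (exactLift ψ L a (c, x)) = c := by
  have h1 : 1 - sphereSlope ψ L a (ψ x, x) ≠ 0 := (sub_pos.2 hs).ne'
  rw [exactLift, map_add, map_smul, h.fderiv_sphereLift c h0 hx]
  simp only
  rw [h.fderiv_sphereLift (ψ x) h0 hx]
  have e : ψ x - sphereSlope ψ L a (ψ x, x) • ψ x =
      (1 - sphereSlope ψ L a (ψ x, x)) • ψ x := by rw [sub_smul, one_smul]
  rw [e, smul_smul, div_mul_cancel₀ _ h1, sub_add_cancel]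

theorem contDiffAt_exactLift (h : IsEulerSubmersion ψ L a R) {q : Euc p × Euc m} (h0 : q.2 ≠ 0)
    (hx : ‖q.2‖ < R) (hs : sphereSlope ψ L a (ψ q.2, q.2) < 1) :
    ContDiffAt ℝ ∞ (exactLift ψ L a) q := by
  have h1 : ContDiffAt ℝ ∞ (fun q : Euc p × Euc m => sphereSlope ψ L a (ψ q.2, q.2)) q :=
    ContDiffAt.comp (g := fun x => sphereSlope ψ L a (ψ x, x)) q
      (h.contDiffAt_selfSlope h0 hx) contDiffAt_snd
  have h2 : ContDiffAt ℝ ∞ (fun q : Euc p × Euc m => sphereLift ψ L (ψ q.2, q.2)) q :=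
    ContDiffAt.comp (g := sphereLift ψ L) (f := fun q : Euc p × Euc m => (ψ q.2, q.2)) q
      (h.contDiffAt_sphereLift (q := (ψ q.2, q.2)) h0 hx)
      (((h.smooth q.2 hx).comp q contDiffAt_snd).prodMk contDiffAt_snd)
  exact (h.contDiffAt_sphereLift h0 hx).add (((h.contDiffAt_sphereSlope h0 hx).div
    (contDiffAt_const.sub h1) (sub_pos.2 hs).ne').smul h2)

theorem exactLift_neg (c : Euc p) (x : Euc m) :
    exactLift ψ L a (-c, x) = -exactLift ψ L a (c, x) := by
  simp only [exactLift, sphereLift_neg, sphereSlope_neg, neg_div, neg_smul]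
  abel

/-- Flowing along `exactLift` near the link translates the values of `ψ`. -/
theorem exists_translation_flow (h : IsEulerSubmersion ψ L a R) (hε : 0 < ε) (hR : ε < R) :
    ∃ δ : ℝ, 0 < δ ∧ ∃ G : ℝ × Euc p × Euc m → Euc m, ContDiff ℝ ∞ G ∧
      ∀ c, ‖c‖ ≤ δ → ∀ x ∈ sphere (0 : Euc m) ε,
        G (1, c, x) ∈ sphere (0 : Euc m) ε ∧ G (1, -c, G (1, c, x)) = x ∧
        (c = 0 → G (1, c, x) = x) ∧
        ((∀ t ∈ Icc (0 : ℝ) 1, ‖ψ x + t • c‖ ≤ δ) → ψ (G (1, c, x)) = ψ x + c) := by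
  obtain ⟨δ, hδ, hslope⟩ := h.exists_tube_slope_lt_one hε hR
  set Q : Set (Euc m) := sphere 0 ε ∩ ψ ⁻¹' closedBall 0 δ with hQ
  have hQc : IsCompact Q := (isCompact_sphere (0 : Euc m) ε).of_isClosed_subset
    ((h.continuousOn_sphere hR).preimage_isClosed_of_isClosed isClosed_sphere isClosed_closedBall)
    inter_subset_left
  set O : Set (Euc m) := {x | x ≠ 0 ∧ ‖x‖ < R} ∩ (fun x => sphereSlope ψ L a (ψ x, x)) ⁻¹' Iio 1
  have hO : IsOpen O := by
    refine ContinuousOn.isOpen_inter_preimage (fun x hx =>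
      (h.contDiffAt_selfSlope hx.1 hx.2).continuousAt.continuousWithinAt) ?_ isOpen_Iio
    exact isOpen_ne.inter (isOpen_lt continuous_norm continuous_const)
  obtain ⟨β, hβ, hβc, hβO, hβ1, hβI⟩ := exists_cutoff hQc hO (fun x hx =>
    ⟨⟨ne_zero_of_mem_sphere hε hx.1, norm_lt_of_mem_sphere hR hx.1⟩,
      hslope x hx.1 (by simpa using hx.2)⟩)
  have hβQ : ∀ x ∈ Q, β x = 1 := fun x hx => hβ1.self_of_nhdsSet x hx
  set Y : Euc p × Euc m → Euc m := fun q => β q.2 • exactLift ψ L a q with hY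
  obtain ⟨G, hGs, hG⟩ := exists_sphere_flow (D := Euc p) δ hε hR (Y := Y)
    (fun d x h0 hx => by
      by_cases hxs : x ∈ tsupport β
      · exact ((hβ.contDiffAt.comp (d, x) contDiffAt_snd).smul
          (h.contDiffAt_exactLift (q := (d, x)) h0 hx (hβO hxs).2))
      · refine (contDiffAt_const (c := (0 : Euc m))).congr_of_eventuallyEq ?_
        have h1 := notMem_tsupport_iff_eventuallyEq.1 hxs
        have h2 : Tendsto (Prod.snd : Euc p × Euc m → Euc m) (𝓝 (d, x)) (𝓝 x) :=
          continuous_snd.tendsto (d, x)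
        filter_upwards [h2.eventually h1] with q hq
        simp only [hY, hq, Pi.zero_apply, zero_smul])
    (fun d x h0 hx => by
      simp only [hY, exactLift]
      rw [inner_smul_right, inner_add_right, inner_smul_right, h.inner_sphereLift d h0,
        h.inner_sphereLift (ψ x) h0, mul_zero, add_zero, mul_zero])
  refine ⟨δ, hδ, G, hGs, fun c hc x hx => ⟨((hG c hc x hx).2.1 1).1, ?_, ?_, fun hseg => ?_⟩⟩
  · exact sphere_flow_reverse (Y := Y)
      (fun d x _ => by simp only [hY, exactLift_neg, smul_neg]) hG hc hx
  · rintro rfl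
    refine ((hG 0 hc x hx).2.2 (fun _ => x) rfl (fun t => ⟨hx, ?_⟩) 1).symm
    have : Y (0, x) = 0 := by
      have e : exactLift ψ L a (0, x) = 0 := by
        simp only [exactLift, sphereLift, sphereSlope, map_zero, inner_zero_left, zero_div,
          zero_smul, zero_mul, sub_zero, add_zero]
      simp only [hY, e, smul_zero]
    rw [this]
    exact hasDerivAt_const _ _
  · obtain ⟨h0, h1, -⟩ := hG c hc x hx
    set γ : ℝ → Euc m := fun t => G (t, c, x) with hγ
    have hγS : ∀ t, γ t ∈ sphere (0 : Euc m) ε := fun t => (h1 t).1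
    have hγc : Continuous γ := continuous_iff_continuousAt.2 fun t => (h1 t).2.continuousAt
    have hψ : ∀ t, HasDerivAt (fun s => ψ (γ s)) (β (γ t) • c) t := fun t => by
      have := h.hasDerivAt_comp_sphere hR (hγS t) (h1 t).2
      convert! this using 1
      simp only [hY]
      rw [map_smul]
      by_cases hxs : γ t ∈ tsupport β
      · rw [h.fderiv_exactLift c (ne_zero_of_mem_sphere hε (hγS t))
          (norm_lt_of_mem_sphere hR (hγS t)) (hβO hxs).2]
      · rw [image_eq_zero_of_notMem_tsupport hxs, zero_smul]
        exact (zero_smul ℝ _).symm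
    have hβγ : Continuous fun t => β (γ t) := hβ.continuous.comp hγc
    have hval : ∀ t, ψ (γ t) = ψ x + (∫ s in (0 : ℝ)..t, β (γ s)) • c := fun t => by
      have h2 := intervalIntegral.integral_eq_sub_of_hasDerivAt (a := 0) (b := t)
        (fun s _ => hψ s) ((hβγ.smul continuous_const).intervalIntegrable _ _)
      have hγ0 : γ 0 = x := h0
      rw [intervalIntegral.integral_smul_const, hγ0] at h2
      rw [h2]
      abel
    -- A cutoff with values in [0, 1] can only slow the motion, so up to time 1 the value of ψ stays
    -- on the segment from ψ(x) to ψ(x) + c. The segment lies in the δ-ball, where the cutoff is 1,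
    -- so there is no slowing at all.
    have hQγ : ∀ t ∈ Icc (0 : ℝ) 1, β (γ t) = 1 := fun t ht => by
      refine hβQ _ ⟨hγS t, ?_⟩
      rw [mem_preimage, mem_closedBall_zero_iff, hval t]
      refine hseg _ ⟨intervalIntegral.integral_nonneg ht.1 fun s _ => (hβI _).1, ?_⟩
      have h3 : ∫ s in (0 : ℝ)..t, β (γ s) ≤ ∫ s in (0 : ℝ)..t, (1 : ℝ) :=
        intervalIntegral.integral_mono_on ht.1 (hβγ.intervalIntegrable _ _)
          (by simp) fun s _ => (hβI _).2
      simp only [intervalIntegral.integral_const, sub_zero, smul_eq_mul, mul_one] at h3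
      exact h3.trans ht.2
    have h4 := hval 1
    have h5 : ∫ s in (0 : ℝ)..1, β (γ s) = 1 := by
      rw [intervalIntegral.integral_congr (g := fun _ => (1 : ℝ)) (fun s hs => by
        rw [uIcc_of_le zero_le_one] at hs
        exact hQγ s hs)]
      simp
    rw [h5, one_smul] at h4
    exact h4

theorem isOpenBook_normalized (h : IsEulerSubmersion ψ L a R) (hε : 0 < ε) (hR : ε < R)
    (hm : 0 < m) (hp : 2 ≤ p) : IsOpenBook ε (link ψ ε) (normalized ψ) := by
  refine ⟨h.isSubmanifoldOfSphere_link hε hR, h.isSmoothFibration_normalized hε hR hm hp, ?_⟩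
  obtain ⟨δ, hδ, G, hGs, hG⟩ := h.exists_translation_flow hε hR
  have hin : ∀ x ∈ sphere 0 ε ∩ (ball 0 R ∩ ψ ⁻¹' ball 0 δ), ‖ψ x‖ < δ := fun x hx => by
    simpa using hx.2.2
  have hfwd : ∀ x ∈ sphere 0 ε ∩ (ball 0 R ∩ ψ ⁻¹' ball 0 δ),
      G (1, -ψ x, x) ∈ link ψ ε ∧ G (1, ψ x, G (1, -ψ x, x)) = x := by
    intro x hx
    have hlt := hin x hx
    obtain ⟨h1, h2, -, h3⟩ := hG (-ψ x) (by rw [norm_neg]; exact hlt.le) x hx.1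
    rw [neg_neg] at h2
    refine ⟨⟨h1, ?_⟩, h2⟩
    rw [h3 (fun t ht => ?_), add_neg_cancel]
    rw [show ψ x + t • -ψ x = (1 - t) • ψ x by rw [sub_smul, one_smul, smul_neg, sub_eq_add_neg],
      norm_smul, Real.norm_of_nonneg (by linarith [ht.2])]
    nlinarith [norm_nonneg (ψ x), ht.1, ht.2]
  have hbwd : ∀ y ∈ ball (0 : Euc p) 1, ∀ k ∈ link ψ ε,
      G (1, δ • y, k) ∈ sphere (0 : Euc m) ε ∧ ψ (G (1, δ • y, k)) = δ • y ∧
      ‖δ • y‖ < δ ∧ G (1, -(δ • y), G (1, δ • y, k)) = k := by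
    intro y hy k hk
    rw [mem_ball_zero_iff] at hy
    have hn : ‖δ • y‖ < δ := by
      rw [norm_smul, Real.norm_of_nonneg hδ.le]
      nlinarith
    obtain ⟨h1, h2, -, h3⟩ := hG (δ • y) hn.le k hk.1
    refine ⟨h1, ?_, hn, h2⟩
    rw [h3 (fun t ht => ?_), hk.2, zero_add]
    rw [hk.2, zero_add, norm_smul, Real.norm_of_nonneg ht.1]
    nlinarith [norm_nonneg (δ • y), ht.1, ht.2]
  -- The chart records ψ(x)/δ and the point of the link reached by translating the value of ψ by
  -- -ψ(x). Scaling by δ⁻¹ fills the unit ball without changing directions.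
  refine ⟨ball 0 R ∩ ψ ⁻¹' ball 0 δ, ?_, ?_, fun x => (δ⁻¹ • ψ x, G (1, -ψ x, x)),
    ⟨?_, ?_, fun q => G (1, δ • q.1, q.2), ?_, ?_, ?_, ?_⟩, ?_, ?_⟩
  · exact ContinuousOn.isOpen_inter_preimage (fun x hx =>
      (h.smooth x (by simpa using hx)).continuousAt.continuousWithinAt) isOpen_ball isOpen_ball
  · intro x hx
    refine ⟨by simpa using norm_lt_of_mem_sphere hR hx.1, ?_⟩
    rw [mem_preimage, hx.2]
    exact mem_ball_self hδ
  · intro x hx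
    have h1 := h.smooth x (norm_lt_of_mem_sphere hR hx.1)
    exact ((h1.const_smul δ⁻¹).prodMk (hGs.contDiffAt.comp x
      (contDiffAt_const.prodMk (h1.neg.prodMk contDiffAt_id)))).contDiffWithinAt
  · intro x hx
    refine ⟨?_, (hfwd x hx).1⟩
    rw [mem_ball_zero_iff, norm_smul, norm_inv, Real.norm_of_nonneg hδ.le,
      inv_mul_lt_one₀ hδ]
    exact hin x hx
  · exact (hGs.comp (contDiff_const.prodMk
      ((contDiff_fst.const_smul δ).prodMk contDiff_snd))).contDiffOn
  · rintro ⟨y, k⟩ ⟨hy, hk⟩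
    obtain ⟨h1, h2, h3, -⟩ := hbwd y hy k hk
    refine ⟨h1, by simpa using norm_lt_of_mem_sphere hR h1, ?_⟩
    rw [mem_preimage, h2, mem_ball_zero_iff]
    exact h3
  · intro x hx
    simp only [smul_inv_smul₀ hδ.ne']
    exact (hfwd x hx).2
  · rintro ⟨y, k⟩ ⟨hy, hk⟩
    obtain ⟨h1, h2, h3, h4⟩ := hbwd y hy k hk
    simp only [h2, h4, inv_smul_smul₀ hδ.ne']
  · intro x hx
    obtain ⟨-, -, h3, -⟩ := hG 0 (by simpa using hδ.le) x hx.1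
    simp only [hx.2, smul_zero, neg_zero, h3 rfl]
  · intro x _
    exact (inv_norm_smul_smul (inv_pos.2 hδ) (ψ x)).symm

end IsEulerSubmersion

/-! ### Integral curves inside a set, and change of time. -/

/-- An integral curve of `X` within `K` runs from `y` to `x`. -/
def FlowsWithin {E : Type*} [NormedAddCommGroup E] [NormedSpace ℝ E] (X : E → E) (K : Set E)
    (y x : E) : Prop :=
  ∃ (a : ℝ) (c : ℝ → E), 0 ≤ a ∧ c 0 = y ∧ c a = x ∧
    ∀ t ∈ Icc 0 a, c t ∈ K ∧ HasDerivWithinAt c (X (c t)) (Icc 0 a) t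

section Reparametrization

/-- S is the inverse of T(s) = ∫₀ˢ 1/q, with q extended by constants beyond [0, b]. Then 1/q has a
positive lower bound and T is a bijection of the line. -/
theorem exists_reparametrization {q : ℝ → ℝ} {b : ℝ} (hb : 0 ≤ b) (hq : ContinuousOn q (Icc 0 b))
    (hpos : ∀ s ∈ Icc 0 b, 0 < q s) :
    ∃ (a : ℝ) (S : ℝ → ℝ), 0 ≤ a ∧ S 0 = 0 ∧ S a = b ∧
      ∀ t ∈ Icc 0 a, S t ∈ Icc 0 b ∧ HasDerivAt S (q (S t)) t := by
  set w : ℝ → ℝ := fun s => (q (projIcc 0 b hb s))⁻¹ with hw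
  have hqc : Continuous fun s => q (projIcc 0 b hb s) :=
    (continuousOn_iff_continuous_domRestrict.1 hq).comp continuous_projIcc
  have hwpos : ∀ s, 0 < w s := fun s => inv_pos.2 (hpos _ (projIcc 0 b hb s).2)
  have hwc : Continuous w := hqc.inv₀ fun s => (hpos _ (projIcc 0 b hb s).2).ne'
  obtain ⟨s₀, -, hs₀⟩ := (isCompact_Icc (a := (0 : ℝ)) (b := b)).exists_isMinOn
    (nonempty_Icc.2 hb) hwc.continuousOn
  have hwmin : ∀ s, w s₀ ≤ w s := fun s => by
    have h1 : w (projIcc 0 b hb s) = w s := by simp [hw]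
    exact h1 ▸ hs₀ (projIcc 0 b hb s).2
  set T : ℝ → ℝ := fun s => ∫ r in (0 : ℝ)..s, w r
  have hT : ∀ s, HasDerivAt T (w s) s := fun s =>
    intervalIntegral.integral_hasDerivAt_right (hwc.intervalIntegrable _ _)
      (hwc.stronglyMeasurableAtFilter _ _) hwc.continuousAt
  have hT0 : T 0 = 0 := by simp [T]
  have hTm : StrictMono T := strictMono_of_deriv_pos fun s => by rw [(hT s).deriv]; exact hwpos s
  have hTc : Continuous T := continuous_iff_continuousAt.2 fun s => (hT s).continuousAt
  have hmono : Monotone fun s => T s - w s₀ * s := by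
    have hd : ∀ s, HasDerivAt (fun s => T s - w s₀ * s) (w s - w s₀ * 1) s := fun s =>
      (hT s).sub ((hasDerivAt_id s).const_mul _)
    refine monotone_of_deriv_nonneg (fun s => (hd s).differentiableAt) fun s => ?_
    rw [(hd s).deriv, mul_one]
    exact sub_nonneg.2 (hwmin s)
  have htop : Tendsto T atTop atTop := by
    refine tendsto_atTop_mono' _ ?_ (tendsto_id.const_mul_atTop (hwpos s₀))
    filter_upwards [eventually_ge_atTop 0] with s hs
    have := hmono hs
    simp only [hT0, mul_zero, sub_zero] at this
    simp only [id]
    linarith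
  have hbot : Tendsto T atBot atBot := by
    refine tendsto_atBot_mono' _ ?_ (tendsto_id.const_mul_atBot (hwpos s₀))
    filter_upwards [eventually_le_atBot 0] with s hs
    have := hmono hs
    simp only [hT0, mul_zero, sub_zero] at this
    simp only [id]
    linarith
  set e := hTm.orderIsoOfSurjective T (hTc.surjective htop hbot) with he
  have heT : ∀ s, e s = T s := fun s => rfl
  have hS0 : e.symm 0 = 0 := by rw [OrderIso.symm_apply_eq, heT, hT0]
  have hSb : e.symm (T b) = b := by rw [OrderIso.symm_apply_eq, heT]
  refine ⟨T b, e.symm, hT0 ▸ hTm.monotone hb, hS0, hSb, fun t ht => ?_⟩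
  have hmem : e.symm t ∈ Icc 0 b := by
    constructor
    · exact hS0 ▸ e.symm.monotone ht.1
    · exact hSb ▸ e.symm.monotone ht.2
  refine ⟨hmem, ?_⟩
  have h1 : HasDerivAt e.symm (w (e.symm t))⁻¹ t :=
    HasDerivAt.of_local_left_inverse e.symm.continuous.continuousAt (hT _) (hwpos _).ne'
      (Eventually.of_forall fun y => e.apply_symm_apply y)
  have h2 : (w (e.symm t))⁻¹ = q (e.symm t) := by
    simp only [hw, inv_inv, projIcc_of_mem hb hmem]
  rwa [h2] at h1

end Reparametrization

/-! ### Moving along integral curves between two faces of a region. -/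

section Inflation

universe u

variable {E : Type u} [NormedAddCommGroup E] [NormedSpace ℝ E]

/-- A field is invariant under its own flow: the derivative of F(s, ·) takes X(x) to X(F(s, x)). -/
theorem IsSmoothFlow.fderiv_apply {X : E → E} {F : ℝ × E → E} (hF : IsSmoothFlow X F) (s : ℝ)
    (x : E) (σ κ : ℝ) : fderiv ℝ F (s, x) (σ, κ • X x) = (σ + κ) • X (F (s, x)) := by
  have hd : HasFDerivAt F (fderiv ℝ F (s, x)) (s, x) :=
    (hF.contDiff.differentiable (by simp) _).hasFDerivAt
  have h1 : fderiv ℝ F (s, x) (1, 0) = X (F (s, x)) :=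
    (hd.comp_hasDerivAt s ((hasDerivAt_id s).prodMk (hasDerivAt_const s x))).unique
      (hF.hasDerivAt x s)
  have h2 : fderiv ℝ F (s, x) (0, X x) = X (F (s, x)) := by
    have hx : HasDerivAt (fun h => F (h, x)) (X x) 0 := by
      have := hF.hasDerivAt x 0
      rwa [hF.zero] at this
    have hd' : HasFDerivAt F (fderiv ℝ F (s, x)) (s, F (0, x)) := by rwa [hF.zero]
    have h3 := hd'.comp_hasDerivAt (0 : ℝ) ((hasDerivAt_const (0 : ℝ) s).prodMk hx)
    have h4 : HasDerivAt (fun h => F (s, F (h, x))) (X (F (s, x))) 0 := by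
      simp only [← hF.add]
      have h5 : HasDerivAt (fun h => F (h, x)) (X (F (s, x))) (s + 0) := by
        rw [add_zero]
        exact hF.hasDerivAt x s
      have := h5.scomp 0 ((hasDerivAt_id (0 : ℝ)).const_add s)
      simpa [Function.comp_def] using this
    exact h3.unique h4
  have e : ((σ, κ • X x) : ℝ × E) = σ • ((1 : ℝ), (0 : E)) + κ • ((0 : ℝ), X x) := by
    simp
  rw [e, map_add, map_smul, map_smul, h1, h2, add_smul]

variable [FiniteDimensional ℝ E]

/-- The flow of the multiple of `X` along which `f` has unit speed, on the region
`{0 ≤ f, g ≤ 0}`. -/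
theorem exists_unit_speed_flow {f g : E → ℝ} (hf : ContDiff ℝ ∞ f) (hg : ContDiff ℝ ∞ g)
    {X : E → E} (hK : IsCompact {x | 0 ≤ f x ∧ g x ≤ 0})
    (hX : ∀ᶠ x in 𝓝ˢ {x | 0 ≤ f x ∧ g x ≤ 0}, ContDiffAt ℝ ∞ X x)
    (hfX : ∀ x, 0 ≤ f x → g x ≤ 0 → 0 < fderiv ℝ f x (X x))
    (hgX : ∀ x, 0 ≤ f x → g x ≤ 0 → 0 < fderiv ℝ g x (X x)) :
    ∃ F : ℝ × E → E, ContDiff ℝ ∞ F ∧ (∀ x, F (0, x) = x) ∧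
      (∀ s t x, F (s + t, x) = F (s, F (t, x))) ∧
      (∀ x, 0 ≤ f x → g x ≤ 0 → ∀ t ∈ Icc 0 (f x), f (F (-t, x)) = f x - t ∧
        g (F (-t, x)) ≤ 0 ∧ HasDerivAt (fun s => F (s, x))
          ((fderiv ℝ f (F (-t, x)) (X (F (-t, x))))⁻¹ • X (F (-t, x))) (-t)) ∧
      ∀ (a : ℝ) (c : ℝ → E), (∀ t ∈ Icc 0 a, (0 ≤ f (c t) ∧ g (c t) ≤ 0) ∧
        HasDerivWithinAt c (X (c t)) (Icc 0 a) t) → ∀ t ∈ Icc 0 a,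
          F (-(f (c t) - f (c 0)), c t) = c 0 := by
  set K : Set E := {x | 0 ≤ f x ∧ g x ≤ 0} with hKdef
  set κ : E → ℝ := fun x => fderiv ℝ f x (X x) with hκ
  have hκs : ∀ x, ContDiffAt ℝ ∞ X x → ContDiffAt ℝ ∞ κ x := fun x hx =>
    (hf.fderiv_right (by norm_cast)).contDiffAt.clm_apply hx
  have hgs : ∀ x, ContDiffAt ℝ ∞ X x → ContDiffAt ℝ ∞ (fun x => fderiv ℝ g x (X x)) x :=
    fun x hx => ((hg.fderiv_right (m := ∞) (by norm_cast)).contDiffAt).clm_apply hx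
  have hpos : ∀ᶠ x in 𝓝ˢ K, ContDiffAt ℝ ∞ X x ∧ 0 < κ x ∧ 0 < fderiv ℝ g x (X x) := by
    rw [eventually_nhdsSet_iff_forall]
    intro x hx
    have hx1 := hX.self_of_nhdsSet x hx
    exact (eventually_nhdsSet_iff_forall.1 hX x hx).and
      (((hκs x hx1).continuousAt.eventually (lt_mem_nhds (hfX x hx.1 hx.2))).and
        ((hgs x hx1).continuousAt.eventually (lt_mem_nhds (hgX x hx.1 hx.2))))
  obtain ⟨X', F, hF, hX'⟩ := exists_isSmoothFlow_of_compact hK (X := fun x => (κ x)⁻¹ • X x)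
    (hpos.mono fun x hx => ((hκs x hx.1).inv hx.2.1.ne').smul hx.1)
  have hnear : ∀ᶠ x in 𝓝ˢ K, fderiv ℝ f x (X' x) = 1 ∧ 0 < fderiv ℝ g x (X' x) := by
    filter_upwards [hpos, hX'] with x ⟨_, h1, h2⟩ h3
    rw [h3, map_smul, map_smul]
    exact ⟨inv_mul_cancel₀ h1.ne', mul_pos (inv_pos.2 h1) h2⟩
  refine ⟨F, hF.contDiff, hF.zero, hF.add, fun x hx0 hx1 => ?_, fun a c hc t ht => ?_⟩
  · set γ : ℝ → E := fun t => F (-t, x) with hγ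
    have hγd : ∀ t, HasDerivAt γ (-X' (γ t)) t := fun t => by
      have := (hF.hasDerivAt x (-t)).scomp t (hasDerivAt_neg t)
      simpa [Function.comp_def] using this
    have hγc : Continuous γ := continuous_iff_continuousAt.2 fun t => (hγd t).continuousAt
    have hfγ : ∀ t, HasDerivAt (fun t => f (γ t)) (-(fderiv ℝ f (γ t) (X' (γ t)))) t := fun t => by
      have := (hf.differentiable (by simp) (γ t)).hasFDerivAt.comp_hasDerivAt t (hγd t)
      rwa [map_neg] at this
    have hgγ : ∀ t, HasDerivAt (fun t => g (γ t)) (-(fderiv ℝ g (γ t) (X' (γ t)))) t := fun t => by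
      have := (hg.differentiable (by simp) (γ t)).hasFDerivAt.comp_hasDerivAt t (hγd t)
      rwa [map_neg] at this
    -- Continuous induction on t: the conditions are closed, and where they hold the curve is in K,
    -- near which f decreases backwards at speed 1 and g does not increase.
    have hmain : Icc 0 (f x) ⊆ {t | f (γ t) = f x - t ∧ g (γ t) ≤ 0} := by
      refine IsClosed.Icc_subset_of_forall_mem_nhdsWithin ?_ ?_ ?_
      · refine IsClosed.inter (IsClosed.inter ?_ ?_) isClosed_Icc
        · exact isClosed_eq (hf.continuous.comp hγc) (by fun_prop)
        · exact isClosed_le (hg.continuous.comp hγc) continuous_const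
      · simp only [hγ, mem_ofPred_eq, neg_zero, hF.zero, sub_zero, true_and]
        exact hx1
      · rintro t ⟨⟨ht1, ht2⟩, ht3⟩
        have htK : γ t ∈ K := ⟨by rw [ht1]; linarith [ht3.2], ht2⟩
        obtain ⟨r, hr, hball⟩ := Metric.eventually_nhds_iff_ball.1
          (hγc.continuousAt.eventually (eventually_nhdsSet_iff_forall.1 hnear _ htK))
        rw [Real.ball_eq_Ioo] at hball
        have htm : t ∈ Ioo (t - r) (t + r) := ⟨by linarith, by linarith⟩
        have hconst : ∀ s ∈ Ioo (t - r) (t + r), f (γ s) + s = f (γ t) + t := by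
          intro s hs
          have hd : ∀ s ∈ Ioo (t - r) (t + r), HasDerivAt (fun s => f (γ s) + s) 0 s := by
            intro s hs
            have := (hfγ s).add (hasDerivAt_id s)
            rwa [(hball s hs).1, neg_add_cancel] at this
          exact isOpen_Ioo.is_const_of_deriv_eq_zero isPreconnected_Ioo
            (fun s hs => (hd s hs).differentiableAt.differentiableWithinAt)
            (fun s hs => (hd s hs).deriv) hs htm
        have hanti : AntitoneOn (fun s => g (γ s)) (Ioo (t - r) (t + r)) := by
          refine antitoneOn_of_deriv_nonpos (convex_Ioo _ _)
            (hg.continuous.comp hγc).continuousOn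
            (fun s _ => (hgγ s).differentiableAt.differentiableWithinAt) fun s hs => ?_
          rw [interior_Ioo] at hs
          rw [(hgγ s).deriv]
          exact neg_nonpos.2 (hball s hs).2.le
        filter_upwards [Ioo_mem_nhdsGT (show t < t + r by linarith)] with s hs
        have hs' : s ∈ Ioo (t - r) (t + r) := ⟨by linarith [hs.1], hs.2⟩
        exact ⟨by linarith [hconst s hs'], (hanti htm hs' hs.1.le).trans ht2⟩
    intro t ht
    obtain ⟨h1, h2⟩ := hmain ht
    refine ⟨h1, h2, ?_⟩
    have hmem : γ t ∈ K := ⟨by rw [h1]; linarith [ht.2], h2⟩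
    have := hF.hasDerivAt x (-t)
    rwa [hX'.self_of_nhdsSet _ hmem] at this
  -- Flowing c(t) back by the amount of f gained since time 0 is locally constant in t: the time
  -- shift contributes -κX', the motion of c contributes κX'.
  · set z : ℝ → E := fun t => F (-(f (c t) - f (c 0)), c t) with hz
    have hzd : ∀ t ∈ Icc 0 a, HasDerivWithinAt z 0 (Icc 0 a) t := by
      intro t ht
      obtain ⟨hcK, hcd⟩ := hc t ht
      have h1 : HasDerivWithinAt (fun t => f (c t)) (κ (c t)) (Icc 0 a) t :=
        (hf.differentiable (by simp) (c t)).hasFDerivAt.comp_hasDerivWithinAt t hcd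
      have h2 := (hF.contDiff.differentiable (by simp)
        (-(f (c t) - f (c 0)), c t)).hasFDerivAt.comp_hasDerivWithinAt t
          (((h1.sub_const (f (c 0))).neg).prodMk hcd)
      have hκ0 : κ (c t) ≠ 0 := (hfX _ hcK.1 hcK.2).ne'
      have e : X (c t) = κ (c t) • X' (c t) := by
        rw [hX'.self_of_nhdsSet _ hcK, smul_inv_smul₀ hκ0]
      have h3 := hF.fderiv_apply (-(f (c t) - f (c 0))) (c t) (-κ (c t)) (κ (c t))
      rw [neg_add_cancel, zero_smul, ← e] at h3
      rwa [h3] at h2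
    have hconst := constant_of_derivWithin_zero
      (fun t ht => (hzd t ht).differentiableWithinAt) (fun t ht => by
        have hlt : (0 : ℝ) < a := ht.1.trans_lt ht.2
        exact (hzd t ⟨ht.1, ht.2.le⟩).derivWithin
          (uniqueDiffOn_Icc hlt t ⟨ht.1, ht.2.le⟩)) t ht
    simp only [hz, sub_self, neg_zero, hF.zero] at hconst
    exact hconst

end Inflation

theorem FlowsWithin.mono {E : Type*} [NormedAddCommGroup E] [NormedSpace ℝ E] {X : E → E}
    {K K' : Set E} {y x : E} (h : FlowsWithin X K y x) (hK : K ⊆ K') : FlowsWithin X K' y x := by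
  obtain ⟨a, c, ha, h0, h1, hc⟩ := h
  exact ⟨a, c, ha, h0, h1, fun t ht => ⟨hK (hc t ht).1, (hc t ht).2⟩⟩

theorem FlowsWithin.congr {E : Type*} [NormedAddCommGroup E] [NormedSpace ℝ E] {X X' : E → E}
    {K : Set E} {y x : E} (h : FlowsWithin X K y x) (hX : ∀ z ∈ K, X z = X' z) :
    FlowsWithin X' K y x := by
  obtain ⟨a, c, ha, h0, h1, hc⟩ := h
  exact ⟨a, c, ha, h0, h1, fun t ht => ⟨(hc t ht).1, hX _ (hc t ht).1 ▸ (hc t ht).2⟩⟩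

theorem FlowsWithin.reverse {E : Type*} [NormedAddCommGroup E] [NormedSpace ℝ E] {X : E → E}
    {K : Set E} {y x : E} (h : FlowsWithin X K y x) : FlowsWithin (fun z => -X z) K x y := by
  obtain ⟨a, c, ha, h0, h1, hc⟩ := h
  have hmaps : MapsTo (fun t => a - t) (Icc 0 a) (Icc 0 a) := fun t ht =>
    ⟨by linarith [ht.2], by linarith [ht.1]⟩
  refine ⟨a, fun t => c (a - t), ha, by simpa using h1, by simpa using h0, fun t ht => ?_⟩
  obtain ⟨h2, h3⟩ := hc _ (hmaps ht)
  refine ⟨h2, ?_⟩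
  have := h3.scomp t ((hasDerivAt_id t).const_sub a).hasDerivWithinAt hmaps
  simpa [Function.comp_def] using this

section Inflation

universe u

variable {E : Type u} [NormedAddCommGroup E] [NormedSpace ℝ E] [FiniteDimensional ℝ E]

/-- The retraction of the region `{0 ≤ f, g ≤ 0}` onto its face `f = 0` along the integral curves
of `X`. -/
theorem exists_deflation {f g : E → ℝ} (hf : ContDiff ℝ ∞ f) (hg : ContDiff ℝ ∞ g)
    {X : E → E} {K : Set E} (hKdef : ∀ x, x ∈ K ↔ 0 ≤ f x ∧ g x ≤ 0) (hK : IsCompact K)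
    (hX : ∀ᶠ x in 𝓝ˢ K, ContDiffAt ℝ ∞ X x)
    (hfX : ∀ x ∈ K, 0 < fderiv ℝ f x (X x))
    (hgX : ∀ x ∈ K, 0 < fderiv ℝ g x (X x)) :
    ∃ A : E → E, ContDiff ℝ ∞ A ∧
      (∀ x ∈ K, A x ∈ K ∧ f (A x) = 0 ∧ FlowsWithin X K (A x) x) ∧
      (∀ x, f x = 0 → A x = x) ∧
      (∀ x₀, f x₀ = 0 → ∀ N ∈ 𝓝 x₀, ∀ᶠ x in 𝓝 x₀, x ∈ K → FlowsWithin X (K ∩ N) (A x) x) ∧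
      ∀ x y, FlowsWithin X K y x → f y = 0 → y = A x := by
  have hKe : K = {x | 0 ≤ f x ∧ g x ≤ 0} := Set.ext hKdef
  obtain ⟨F, hFs, hF0, hFa, hF1, hF2⟩ := exists_unit_speed_flow hf hg (hKe ▸ hK) (hKe ▸ hX)
    (fun x h1 h2 => hfX x ((hKdef x).2 ⟨h1, h2⟩)) (fun x h1 h2 => hgX x ((hKdef x).2 ⟨h1, h2⟩))
  have hκc : ∀ x ∈ K, ContinuousAt (fun x => fderiv ℝ f x (X x)) x := fun x hx =>
    (((hf.fderiv_right (m := ∞) (by norm_cast)).contDiffAt).clm_apply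
      (hX.self_of_nhdsSet x hx)).continuousAt
  have hmem : ∀ x ∈ K, ∀ t ∈ Icc 0 (f x), F (-t, x) ∈ K := fun x hx t ht => by
    obtain ⟨h1, h2, -⟩ := hF1 x ((hKdef x).1 hx).1 ((hKdef x).1 hx).2 t ht
    exact (hKdef _).2 ⟨by rw [h1]; linarith [ht.2], h2⟩
  have hcurve : ∀ N : Set E, ∀ x ∈ K, (∀ t ∈ Icc 0 (f x), F (-t, x) ∈ N) →
      FlowsWithin X (K ∩ N) (F (-f x, x)) x := by
    intro N x hx hN
    obtain ⟨hx1, hx2⟩ := (hKdef x).1 hx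
    have hflip : ∀ s ∈ Icc 0 (f x), f x - s ∈ Icc 0 (f x) := fun s hs =>
      ⟨by linarith [hs.2], by linarith [hs.1]⟩
    have hmem' : ∀ s ∈ Icc 0 (f x), F (s - f x, x) ∈ K ∩ N := fun s hs => by
      have h1 := hmem x hx _ (hflip s hs)
      have h2 := hN _ (hflip s hs)
      rw [neg_sub] at h1 h2
      exact ⟨h1, h2⟩
    -- The trajectory has unit speed in f; the new time makes it an integral curve of X itself.
    obtain ⟨a, S, ha, hS0, hSa, hS⟩ := exists_reparametrization hx1
      (q := fun s => fderiv ℝ f (F (s - f x, x)) (X (F (s - f x, x))))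
      (fun s hs => (ContinuousAt.comp (g := fun x => fderiv ℝ f x (X x))
        (f := fun s => F (s - f x, x)) (hκc _ (hmem' s hs).1)
        (hFs.continuous.comp (by fun_prop)).continuousAt).continuousWithinAt)
      (fun s hs => hfX _ (hmem' s hs).1)
    refine ⟨a, fun t => F (S t - f x, x), ha, by simp [hS0], by simp [hSa, hF0], fun t ht => ?_⟩
    obtain ⟨h1, h2⟩ := hS t ht
    refine ⟨hmem' _ h1, ?_⟩
    obtain ⟨-, -, h3⟩ := hF1 x hx1 hx2 _ (hflip _ h1)
    rw [neg_sub] at h3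
    have h4 := h3.scomp t (h2.sub_const (f x))
    rw [smul_inv_smul₀ (hfX _ (hmem' _ h1).1).ne'] at h4
    exact h4.hasDerivWithinAt
  refine ⟨fun x => F (-f x, x), hFs.comp (hf.neg.prodMk contDiff_id), fun x hx => ?_,
    fun x hx => by simp [hx, hF0], fun x₀ hx₀ N hN => ?_, fun x y hyx hy => ?_⟩
  · obtain ⟨hx1, hx2⟩ := (hKdef x).1 hx
    obtain ⟨h1, -, -⟩ := hF1 x hx1 hx2 _ ⟨hx1, le_rfl⟩
    exact ⟨hmem x hx _ ⟨hx1, le_rfl⟩, by rw [h1, sub_self],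
      (hcurve univ x hx fun _ _ => trivial).mono inter_subset_left⟩
  -- The time f(x) needed to reach the face tends to 0 as x → x₀, so the whole trajectory stays in
  -- N.
  · have hc : Tendsto (fun q : ℝ × E => F (-q.1, q.2)) (𝓝 0 ×ˢ 𝓝 x₀) (𝓝 x₀) := by
      have h1 : Continuous fun q : ℝ × E => F (-q.1, q.2) := hFs.continuous.comp (by fun_prop)
      have h2 := h1.tendsto (0, x₀)
      simpa only [neg_zero, hF0, nhds_prod_eq] using h2
    obtain ⟨P, hP, U, hU, hPU⟩ := eventually_prod_iff.1 (hc.eventually hN)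
    obtain ⟨r, hr, hrP⟩ := Metric.eventually_nhds_iff_ball.1 hP
    have hlt : ∀ᶠ x in 𝓝 x₀, f x < r :=
      hf.continuous.continuousAt.eventually_lt continuousAt_const (by rwa [hx₀])
    filter_upwards [hU, hlt] with x hxU hxr hxK
    refine hcurve N x hxK fun t ht => hPU (hrP t ?_) hxU
    rw [mem_ball_zero_iff, Real.norm_of_nonneg ht.1]
    exact ht.2.trans_lt hxr
  · obtain ⟨a, c, ha, h0, h1, hc⟩ := hyx
    have := hF2 a c (fun t ht => ⟨(hKdef _).1 (hc t ht).1, (hc t ht).2⟩) a ⟨ha, le_rfl⟩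
    rw [h0, h1, hy, sub_zero] at this
    exact this.symm

/-- The integral curves of `X` identify the faces `f = 0` and `g = 0` of the region
`{0 ≤ f, g ≤ 0}`. -/
theorem exists_inflation {f g : E → ℝ} (hf : ContDiff ℝ ∞ f) (hg : ContDiff ℝ ∞ g)
    {X : E → E} {K : Set E} (hKdef : ∀ x, x ∈ K ↔ 0 ≤ f x ∧ g x ≤ 0) (hK : IsCompact K)
    (hX : ∀ᶠ x in 𝓝ˢ K, ContDiffAt ℝ ∞ X x)
    (hfX : ∀ x ∈ K, 0 < fderiv ℝ f x (X x))
    (hgX : ∀ x ∈ K, 0 < fderiv ℝ g x (X x)) :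
    ∃ A B : E → E, ContDiff ℝ ∞ A ∧ ContDiff ℝ ∞ B ∧
      (∀ x ∈ K, A x ∈ K ∧ f (A x) = 0 ∧ FlowsWithin X K (A x) x) ∧
      (∀ y ∈ K, B y ∈ K ∧ g (B y) = 0 ∧ FlowsWithin X K y (B y)) ∧
      (∀ x, f x = 0 → A x = x) ∧
      (∀ x₀, f x₀ = 0 → ∀ N ∈ 𝓝 x₀, ∀ᶠ x in 𝓝 x₀, x ∈ K → FlowsWithin X (K ∩ N) (A x) x) ∧
      (∀ x y, FlowsWithin X K y x → f y = 0 → y = A x) ∧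
      ∀ x y, FlowsWithin X K y x → g x = 0 → x = B y := by
  obtain ⟨A, hA, hA1, hA2, hA3, hA4⟩ := exists_deflation hf hg hKdef hK hX hfX hgX
  -- The same retraction for -X, with -g and -f in place of f and g: the region is unchanged and the
  -- target face is now g = 0.
  obtain ⟨B, hB, hB1, -, -, hB4⟩ := exists_deflation (X := fun x => -X x) hg.neg hf.neg
    (fun x => by rw [hKdef x, neg_nonneg, neg_nonpos]; exact and_comm) hK
    (hX.mono fun x hx => hx.neg)
    (fun x hx => by
      have : fderiv ℝ (-g) x = -fderiv ℝ g x := fderiv_neg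
      change 0 < fderiv ℝ (-g) x _
      rw [this, map_neg, neg_apply, neg_neg]
      exact hgX x hx)
    (fun x hx => by
      have : fderiv ℝ (-f) x = -fderiv ℝ f x := fderiv_neg
      change 0 < fderiv ℝ (-f) x _
      rw [this, map_neg, neg_apply, neg_neg]
      exact hfX x hx)
  refine ⟨A, B, hA, hB, hA1, fun y hy => ?_, hA2, hA3, hA4, fun x y hyx hx => ?_⟩
  · obtain ⟨h1, h2, h3⟩ := hB1 y hy
    refine ⟨h1, neg_eq_zero.1 h2, ?_⟩
    simpa only [neg_neg] using h3.reverse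
  · exact hB4 y x hyx.reverse (by simp [hx])

end Inflation

/-! ### Transport of open books by diffeomorphisms. -/

section Transport

variable {ε : ℝ}

/-- An open book structure is carried over by a diffeomorphism of the sphere that fixes the
binding pointwise. -/
theorem IsOpenBook.transport {K : Set (Euc m)} {θ θ' : Euc m → Euc p} (h : IsOpenBook ε K θ')
    {Φ Ψ : Euc m → Euc m} (hΦ : ContDiffOn ℝ ∞ Φ (sphere 0 ε))
    (hΨ : ContDiffOn ℝ ∞ Ψ (sphere 0 ε)) (hΦm : MapsTo Φ (sphere 0 ε) (sphere 0 ε))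
    (hΨm : MapsTo Ψ (sphere 0 ε) (sphere 0 ε)) (hinv : InvOn Ψ Φ (sphere 0 ε) (sphere 0 ε))
    (hK : ∀ x ∈ K, Φ x = x) (hθ : ∀ x ∈ sphere 0 ε \ K, θ' (Φ x) = θ x) : IsOpenBook ε K θ := by
  have hKS : K ⊆ sphere 0 ε := h.binding.2.1
  have hKΨ : ∀ x ∈ K, Ψ x = x := fun x hx => by
    conv_lhs => rw [← hK x hx]
    exact hinv.1 (hKS hx)
  have hΦc : MapsTo Φ (sphere 0 ε \ K) (sphere 0 ε \ K) := fun x hx =>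
    ⟨hΦm hx.1, fun hk => hx.2 (by rwa [← hinv.1 hx.1, hKΨ _ hk])⟩
  have hΨc : MapsTo Ψ (sphere 0 ε \ K) (sphere 0 ε \ K) := fun x hx =>
    ⟨hΨm hx.1, fun hk => hx.2 (by rwa [← hinv.2 hx.1, hK _ hk])⟩
  have hθ' : ∀ x ∈ sphere 0 ε \ K, θ (Ψ x) = θ' x := fun x hx => by
    rw [← hθ _ (hΨc hx), hinv.2 hx.1]
  obtain ⟨h1, h2, h3, h4⟩ := h.fibration
  refine ⟨h.binding, ⟨?_, fun x hx => ?_, fun u hu => ?_, fun b hb => ?_⟩, ?_⟩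
  · exact (h1.comp (hΦ.mono sdiff_subset) hΦc).congr fun x hx => (hθ x hx).symm
  · rw [← hθ x hx]
    exact h2 (hΦc hx)
  · obtain ⟨x, hx, rfl⟩ := h3 hu
    exact ⟨Ψ x, hΨc hx, hθ' x hx⟩
  · obtain ⟨U, hU, hbU, φ, ⟨hφ, hφm, γ, hγ, hγm, hγi⟩, hφ1⟩ := h4 b hb
    have hm1 : MapsTo Φ ((sphere 0 ε \ K) ∩ θ ⁻¹' U) ((sphere 0 ε \ K) ∩ θ' ⁻¹' U) :=
      fun x hx => ⟨hΦc hx.1, by rw [mem_preimage, hθ x hx.1]; exact hx.2⟩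
    have hm2 : ∀ V : Set (Euc p),
        MapsTo Ψ ((sphere 0 ε \ K) ∩ θ' ⁻¹' V) ((sphere 0 ε \ K) ∩ θ ⁻¹' V) :=
      fun V x hx => ⟨hΨc hx.1, by rw [mem_preimage, hθ' x hx.1]; exact hx.2⟩
    have hm3 : MapsTo Φ ((sphere 0 ε \ K) ∩ θ ⁻¹' {b}) ((sphere 0 ε \ K) ∩ θ' ⁻¹' {b}) :=
      fun x hx => ⟨hΦc hx.1, by rw [mem_preimage, hθ x hx.1]; exact hx.2⟩
    -- The trivialization of θ' ends in a fibre of θ'; Ψ brings it back to the fibre of θ.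
    refine ⟨U, hU, hbU, fun x => ((φ (Φ x)).1, Ψ (φ (Φ x)).2), ⟨?_, ?_,
      fun q => Ψ (γ (q.1, Φ q.2)), ?_, ?_, ?_, ?_⟩, ?_⟩
    · have h5 : ContDiffOn ℝ ∞ (fun x => φ (Φ x)) ((sphere 0 ε \ K) ∩ θ ⁻¹' U) :=
        hφ.comp (hΦ.mono (inter_subset_left.trans sdiff_subset)) hm1
      exact h5.fst.prodMk (hΨ.comp h5.snd fun x hx => (hφm (hm1 hx)).2.1.1)
    · exact fun x hx => ⟨(hφm (hm1 hx)).1, hm2 _ (hφm (hm1 hx)).2⟩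
    · refine hΨ.comp (hγ.comp (contDiffOn_fst.prodMk (hΦ.comp contDiffOn_snd ?_)) ?_) ?_
      · exact fun q hq => hq.2.1.1
      · exact fun q hq => ⟨hq.1, hm3 hq.2⟩
      · exact fun q hq => (hγm ⟨hq.1, hm3 hq.2⟩ : γ (q.1, Φ q.2) ∈ _).1.1
    · exact fun q hq => hm2 _ (hγm ⟨hq.1, hm3 hq.2⟩)
    · intro x hx
      simp only [hinv.2 (hφm (hm1 hx)).2.1.1, Prod.mk.eta, hγi.1 (hm1 hx), hinv.1 hx.1.1]
    · intro q hq
      have h6 : (q.1, Φ q.2) ∈ (sphere 0 1 ∩ U) ×ˢ ((sphere 0 ε \ K) ∩ θ' ⁻¹' {b}) :=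
        ⟨hq.1, hm3 hq.2⟩
      simp only [hinv.2 (hγm h6).1.1, hγi.2 h6, hinv.1 hq.2.1.1]
    · intro x hx
      simp only
      rw [hφ1 _ (hm1 hx), hθ x hx.1]
  · obtain ⟨W, hW, hKW, φ, ⟨hφ, hφm, γ, hγ, hγm, hγi⟩, hφK, hφθ⟩ := h.near_binding
    obtain ⟨W', hW', hWe⟩ := continuousOn_iff'.1 hΦ.continuousOn W hW
    have hmem : ∀ x ∈ sphere (0 : Euc m) ε, x ∈ W' ↔ Φ x ∈ W := fun x hx =>
      ⟨fun h => (hWe.symm ▸ (⟨h, hx⟩ : x ∈ W' ∩ sphere 0 ε) : x ∈ Φ ⁻¹' W ∩ sphere 0 ε).1,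
        fun h => (hWe ▸ (⟨h, hx⟩ : x ∈ Φ ⁻¹' W ∩ sphere 0 ε) : x ∈ W' ∩ sphere 0 ε).1⟩
    have hm1 : MapsTo Φ (sphere 0 ε ∩ W') (sphere 0 ε ∩ W) := fun x hx =>
      ⟨hΦm hx.1, (hmem x hx.1).1 hx.2⟩
    have hm2 : MapsTo Ψ (sphere 0 ε ∩ W) (sphere 0 ε ∩ W') := fun x hx =>
      ⟨hΨm hx.1, (hmem _ (hΨm hx.1)).2 (by rw [hinv.2 hx.1]; exact hx.2)⟩
    refine ⟨W', hW', fun x hx => (hmem x (hKS hx)).2 (by rw [hK x hx]; exact hKW hx),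
      fun x => φ (Φ x), ⟨hφ.comp (hΦ.mono inter_subset_left) hm1, hφm.comp hm1,
        fun q => Ψ (γ q), hΨ.comp hγ fun q hq => (hγm hq).1, hm2.comp hγm, ?_, ?_⟩, ?_, ?_⟩
    · intro x hx
      simp only [hγi.1 (hm1 hx), hinv.1 hx.1]
    · intro q hq
      simp only [hinv.2 (hγm hq).1, hγi.2 hq]
    · intro x hx
      simp only [hK x hx, hφK x hx]
    · intro x hx
      rw [← hθ x ⟨hx.1.1, hx.2⟩]
      exact hφθ _ ⟨hm1 hx.1, (hΦc ⟨hx.1.1, hx.2⟩).2⟩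

end Transport

/-! ### Inflating fields and Milnor maps. -/

variable {ψ : Euc m → Euc p} {L : Euc m →L[ℝ] Euc m} {a R ε η : ℝ}

theorem inner_gradient (f : Euc m → ℝ) (x v : Euc m) :
    inner ℝ v (gradient f x) = fderiv ℝ f x v := by
  rw [real_inner_comm, gradient, InnerProductSpace.toDual_symm_apply]

/-- The part of the ball outside the open tube `‖ψ‖ < η`. -/
def outerRegion (ψ : Euc m → Euc p) (ε η : ℝ) : Set (Euc m) :=
  {x | x ∈ closedBall 0 ε ∧ η ≤ ‖ψ x‖}

theorem FlowsWithin.left_mem {E : Type*} [NormedAddCommGroup E] [NormedSpace ℝ E] {X : E → E}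
    {K : Set E} {y x : E} (h : FlowsWithin X K y x) : y ∈ K := by
  obtain ⟨a, c, ha, rfl, -, hc⟩ := h
  exact (hc 0 ⟨le_rfl, ha⟩).1

theorem inflatesTo_iff {v : Euc m → Euc m} {y x : Euc m} :
    InflatesTo ψ ε η v y x ↔
      ‖ψ y‖ = η ∧ x ∈ sphere 0 ε ∧ FlowsWithin v (outerRegion ψ ε η) y x := by
  refine and_congr_right fun _ => and_congr_right fun _ => ?_
  constructor
  · rintro ⟨a, c, ha, h0, h1, hc⟩
    exact ⟨a, c, ha, h0, h1, fun t ht => ⟨⟨(hc t ht).1, (hc t ht).2.1⟩, (hc t ht).2.2⟩⟩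
  · rintro ⟨a, c, ha, h0, h1, hc⟩
    exact ⟨a, c, ha, h0, h1, fun t ht => ⟨(hc t ht).1.1, (hc t ht).1.2, (hc t ht).2⟩⟩

namespace IsEulerSubmersion

theorem map_zero (h : IsEulerSubmersion ψ L a R) (hR : 0 < R) : ψ 0 = 0 := by
  have := h.euler 0 (by simpa using hR)
  rw [_root_.map_zero, _root_.map_zero, eq_comm, smul_eq_zero] at this
  exact this.resolve_left h.degree_pos.ne'

theorem hasFDerivAt_norm_sq (h : IsEulerSubmersion ψ L a R) {x : Euc m} (hx : ‖x‖ < R) :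
    HasFDerivAt (fun y => ‖ψ y‖ ^ 2) (2 • (innerSL ℝ (ψ x)).comp (fderiv ℝ ψ x)) x :=
  (h.differentiableAt hx).hasFDerivAt.norm_sq

/-- By Euler's identity the derivative of ‖ψ‖² along L is 2a‖ψ‖², so L is inflating and radial for
every η. -/
theorem isInflatingField_linear (h : IsEulerSubmersion ψ L a R) (hε : 0 < ε) (hR : ε < R) (η : ℝ) :
    IsInflatingField ψ ε η L := by
  have hne : ∀ x, ψ x ≠ 0 → x ≠ 0 := fun x hx h0 => hx (h0 ▸ h.map_zero (hε.trans hR))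
  refine ⟨Eventually.of_forall fun x => L.contDiff.contDiffAt,
    fun x _ h0 => h.transverse x (hne x h0), fun x hx h0 => ?_, ?_⟩
  · have hxR : ‖x‖ < R := (mem_closedBall_zero_iff.1 hx).trans_lt hR
    rw [inner_gradient, (h.hasFDerivAt_norm_sq hxR).fderiv]
    simp only [smul_apply, ContinuousLinearMap.comp_apply, h.euler x hxR,
      innerSL_apply_apply, inner_smul_right, real_inner_self_eq_norm_sq]
    have := h.degree_pos
    have := norm_pos_iff.2 h0
    simp only [nsmul_eq_mul]
    positivity
  · refine mem_nhdsSet_iff_exists.2 ⟨ball 0 R, isOpen_ball, fun x hx => ?_, fun x hx => ?_⟩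
    · simpa using norm_lt_of_mem_sphere hR hx.1
    · exact ⟨a, h.euler x (by simpa using hx)⟩

/-- The tube and the sphere are identified along the integral curves of an inflating field. -/
theorem exists_tube_sphere_maps (h : IsEulerSubmersion ψ L a R) (hε : 0 < ε) (hR : ε < R)
    (hη : 0 < η) {v : Euc m → Euc m} (hv : IsInflatingField ψ ε η v) :
    ∃ A B : Euc m → Euc m, ContDiff ℝ ∞ A ∧ ContDiff ℝ ∞ B ∧
      (∀ x ∈ outerRegion ψ ε η, A x ∈ outerRegion ψ ε η ∧ ‖ψ (A x)‖ = η ∧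
        FlowsWithin v (outerRegion ψ ε η) (A x) x) ∧
      (∀ y ∈ outerRegion ψ ε η, B y ∈ outerRegion ψ ε η ∧ B y ∈ sphere (0 : Euc m) ε ∧
        FlowsWithin v (outerRegion ψ ε η) y (B y)) ∧
      (∀ x ∈ closedBall (0 : Euc m) ε, ‖ψ x‖ = η → A x = x) ∧
      (∀ x₀ ∈ closedBall (0 : Euc m) ε, ‖ψ x₀‖ = η → ∀ N ∈ 𝓝 x₀, ∀ᶠ x in 𝓝 x₀,
        x ∈ outerRegion ψ ε η → FlowsWithin v (outerRegion ψ ε η ∩ N) (A x) x) ∧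
      (∀ x y, FlowsWithin v (outerRegion ψ ε η) y x → ‖ψ y‖ = η → y = A x) ∧
      ∀ x y, FlowsWithin v (outerRegion ψ ε η) y x → x ∈ sphere (0 : Euc m) ε → x = B y := by
  obtain ⟨β, hβ, -, hβO, hβ1, -⟩ := exists_cutoff (isCompact_closedBall (0 : Euc m) ε)
    isOpen_ball (closedBall_subset_ball hR)
  -- The cutoff makes f smooth on the whole space, ψ being smooth only on a ball; it is 1 near the
  -- closed ball of radius ε, so the region is not affected.
  set f : Euc m → ℝ := fun x => β x • ‖ψ x‖ ^ 2 - η ^ 2 with hf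
  set g : Euc m → ℝ := fun x => ‖x‖ ^ 2 - ε ^ 2 with hg
  have hfs : ContDiff ℝ ∞ f := (contDiff_cutoff_smul (X := fun x => ‖ψ x‖ ^ 2) hβ fun x hx =>
    (h.smooth x (by simpa using hβO hx)).norm_sq ℝ).sub contDiff_const
  have hgs : ContDiff ℝ ∞ g := (contDiff_norm_sq ℝ).sub contDiff_const
  have hfe : ∀ x ∈ closedBall (0 : Euc m) ε, f =ᶠ[𝓝 x] fun y => ‖ψ y‖ ^ 2 - η ^ 2 := fun x hx => by
    filter_upwards [eventually_nhdsSet_iff_forall.1 hβ1 x hx] with y hy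
    simp only [hf, hy, one_smul]
  have hf1 : ∀ x ∈ closedBall (0 : Euc m) ε, f x = ‖ψ x‖ ^ 2 - η ^ 2 := fun x hx =>
    (hfe x hx).self_of_nhds
  have hf0 : ∀ x ∈ closedBall (0 : Euc m) ε, f x = 0 ↔ ‖ψ x‖ = η := fun x hx => by
    rw [hf1 x hx, sub_eq_zero, pow_left_inj₀ (norm_nonneg _) hη.le two_ne_zero]
  have hg0 : ∀ x, g x = 0 ↔ x ∈ sphere (0 : Euc m) ε := fun x => by
    rw [mem_sphere_zero_iff_norm, ← pow_left_inj₀ (norm_nonneg _) hε.le two_ne_zero]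
    exact sub_eq_zero
  have hgb : ∀ x, g x ≤ 0 ↔ x ∈ closedBall (0 : Euc m) ε := fun x => by
    rw [mem_closedBall_zero_iff, ← pow_le_pow_iff_left₀ (norm_nonneg _) hε.le two_ne_zero]
    exact sub_nonpos
  have hK : ∀ x, x ∈ outerRegion ψ ε η ↔ 0 ≤ f x ∧ g x ≤ 0 := fun x => by
    rw [and_comm, hgb]
    refine and_congr_right fun hx => ?_
    rw [hf1 x hx, sub_nonneg, pow_le_pow_iff_left₀ hη.le (norm_nonneg _) two_ne_zero]
  have hKc : IsCompact (outerRegion ψ ε η) := by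
    refine (isCompact_closedBall (0 : Euc m) ε).of_isClosed_subset ?_ fun x hx => hx.1
    rw [show outerRegion ψ ε η = {x | 0 ≤ f x ∧ g x ≤ 0} from Set.ext hK]
    exact (isClosed_le continuous_const hfs.continuous).inter
      (isClosed_le hgs.continuous continuous_const)
  have hne : ∀ x ∈ outerRegion ψ ε η, ψ x ≠ 0 := fun x hx =>
    norm_pos_iff.1 (hη.trans_le hx.2)
  obtain ⟨A, B, hA, hB, hA1, hB1, hA2, hA3, hA4, hB4⟩ := exists_inflation hfs hgs (X := v) hK hKc
    (hv.smooth.filter_mono (nhdsSet_mono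
      (show outerRegion ψ ε η ⊆ closedBall 0 ε ∩ {x | ψ x ≠ 0} from
        fun x hx => ⟨hx.1, hne x hx⟩)))
    (fun x hx => by
      have h1 := hv.outward_tube x hx.1 (hne x hx)
      rw [inner_gradient] at h1
      rwa [(hfe x hx.1).fderiv_eq, fderiv_sub_const])
    (fun x hx => by
      have h1 := hv.outward_ball x hx.1 (hne x hx)
      have h2 : HasFDerivAt g (2 • (innerSL ℝ x).comp (ContinuousLinearMap.id ℝ (Euc m))) x :=
        (hasFDerivAt_id x).norm_sq.sub_const _
      rw [h2.fderiv]
      simp only [smul_apply, ContinuousLinearMap.comp_apply, innerSL_apply_apply, nsmul_eq_mul,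
        ContinuousLinearMap.id_apply]
      rw [real_inner_comm] at h1
      positivity)
  refine ⟨A, B, hA, hB, fun x hx => ?_, fun y hy => ?_, fun x hx h0 => hA2 x ((hf0 x hx).2 h0),
    fun x hx h0 => hA3 x ((hf0 x hx).2 h0), fun x y hyx h0 => hA4 x y hyx
      ((hf0 y hyx.left_mem.1).2 h0), fun x y hyx h0 => hB4 x y hyx ((hg0 x).2 h0)⟩
  · obtain ⟨h1, h2, h3⟩ := hA1 x hx
    exact ⟨h1, (hf0 _ h1.1).1 h2, h3⟩
  · obtain ⟨h1, h2, h3⟩ := hB1 y hy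
    exact ⟨h1, (hg0 _).1 h2, h3⟩

/-- An inflating field may be modified away from the corner `{‖x‖ = ε, ‖ψ x‖ = η}` to one that is
tangent to the fibres of `ψ / ‖ψ‖` everywhere. -/
theorem exists_radial_field (h : IsEulerSubmersion ψ L a R) (hε : 0 < ε) (hR : ε < R)
    {v : Euc m → Euc m} (hv : IsInflatingField ψ ε η v) :
    ∃ v', IsInflatingField ψ ε η v' ∧
      (∀ x ∈ closedBall (0 : Euc m) ε, ∃ c : ℝ, fderiv ℝ ψ x (v' x) = c • ψ x) ∧
      ∀ᶠ x in 𝓝ˢ (sphere (0 : Euc m) ε ∩ {x | ‖ψ x‖ = η}), v' x = v x := by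
  obtain ⟨N, hN, hCN, hrad⟩ := mem_nhdsSet_iff_exists.1 hv.radial
  have hC : IsCompact (sphere (0 : Euc m) ε ∩ {x | ‖ψ x‖ = η}) :=
    (isCompact_sphere (0 : Euc m) ε).of_isClosed_subset
      ((h.continuousOn_sphere hR).norm.preimage_isClosed_of_isClosed isClosed_sphere
        isClosed_singleton) inter_subset_left
  obtain ⟨χ, hχ, -, hχN, hχ1, hχI⟩ := exists_cutoff hC hN hCN
  have hL := h.isInflatingField_linear hε hR η
  have hpos : ∀ x, ∀ r s : ℝ, 0 < r → 0 < s → 0 < χ x * r + (1 - χ x) * s := fun x r s hr hs => by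
    obtain ⟨h0, h1⟩ := hχI x
    rcases h0.eq_or_lt with h2 | h2
    · rw [← h2]
      simpa using hs
    · have := mul_pos h2 hr
      have := mul_nonneg (sub_nonneg.2 h1) hs.le
      linarith
  have hradR : ∀ x : Euc m, ‖x‖ < R →
      ∃ c : ℝ, fderiv ℝ ψ x (χ x • v x + (1 - χ x) • L x) = c • ψ x := by
    intro x hxR
    by_cases hx : x ∈ tsupport χ
    · obtain ⟨c, hc⟩ := hrad (hχN hx)
      refine ⟨χ x * c + (1 - χ x) * a, ?_⟩
      rw [map_add, map_smul, map_smul, hc, h.euler x hxR, smul_smul, smul_smul, add_smul]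
    · refine ⟨a, ?_⟩
      rw [image_eq_zero_of_notMem_tsupport hx, zero_smul, zero_add, sub_zero, one_smul,
        h.euler x hxR]
  -- All requirements are stable under convex combinations, and χ is supported where v is radial.
  refine ⟨fun x => χ x • v x + (1 - χ x) • L x, ⟨?_, fun x hx h0 => ?_, fun x hx h0 => ?_, ?_⟩,
    fun x hx => hradR x ((mem_closedBall_zero_iff.1 hx).trans_lt hR), ?_⟩
  · filter_upwards [hv.smooth] with x hx
    exact (hχ.contDiffAt.smul hx).add
      ((contDiffAt_const.sub hχ.contDiffAt).smul L.contDiff.contDiffAt)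
  · rw [inner_add_left, real_inner_smul_left, real_inner_smul_left]
    exact hpos x _ _ (hv.outward_ball x hx h0) (hL.outward_ball x hx h0)
  · rw [inner_add_left, real_inner_smul_left, real_inner_smul_left]
    exact hpos x _ _ (hv.outward_tube x hx h0) (hL.outward_tube x hx h0)
  · refine mem_nhdsSet_iff_exists.2 ⟨ball 0 R, isOpen_ball, fun x hx => ?_, fun x hx => ?_⟩
    · simpa using norm_lt_of_mem_sphere hR hx.1
    · exact hradR x (by simpa using hx)
  · filter_upwards [hχ1] with x hx
    simp [hx]

theorem normalized_eq_of_flowsWithin (h : IsEulerSubmersion ψ L a R) (hR : ε < R) (hη : 0 < η)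
    {v : Euc m → Euc m}
    (hv : ∀ x ∈ closedBall (0 : Euc m) ε, ∃ c : ℝ, fderiv ℝ ψ x (v x) = c • ψ x) {y x : Euc m}
    (hyx : FlowsWithin v (outerRegion ψ ε η) y x) : normalized ψ x = normalized ψ y := by
  obtain ⟨b, c, hb, rfl, rfl, hc⟩ := hyx
  choose! κ hκ using hv
  refine inv_norm_smul_const_of_radial (u := fun t => ψ (c t)) (κ := fun t => κ (c t)) (a := b)
    (fun t ht => ?_) (fun t ht => norm_pos_iff.1 (hη.trans_le (hc t ht).1.2)) ⟨hb, le_rfl⟩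
  have hcb := (hc t ht).1.1
  rw [← hκ _ hcb]
  exact (h.differentiableAt
    ((mem_closedBall_zero_iff.1 hcb).trans_lt hR)).hasFDerivAt.comp_hasDerivWithinAt t (hc t ht).2

/-- Near a point with ‖ψ‖ = η both branches are the identity on the sphere, so gluing loses no
smoothness. -/
theorem contDiffOn_ite_tube (h : IsEulerSubmersion ψ L a R) (hR : ε < R) {T : Euc m → Euc m}
    (hT : ContDiff ℝ ∞ T)
    (hcorner : ∀ x₀ ∈ sphere (0 : Euc m) ε, ‖ψ x₀‖ = η →
      ∀ᶠ x in 𝓝 x₀, x ∈ sphere (0 : Euc m) ε → η ≤ ‖ψ x‖ → T x = x) :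
    ContDiffOn ℝ ∞ (fun x => if ‖ψ x‖ < η then x else T x) (sphere 0 ε) := by
  intro x hx
  have hc : ContinuousAt (fun x => ‖ψ x‖) x :=
    (h.smooth x (norm_lt_of_mem_sphere hR hx)).continuousAt.norm
  rcases lt_trichotomy ‖ψ x‖ η with hlt | heq | hgt
  · refine (contDiffAt_id.congr_of_eventuallyEq ?_).contDiffWithinAt
    filter_upwards [hc.eventually_lt continuousAt_const hlt] with y hy
    simp [hy]
  · refine contDiffWithinAt_id.congr_of_eventuallyEq_of_mem ?_ hx
    filter_upwards [nhdsWithin_le_nhds (hcorner x hx heq), self_mem_nhdsWithin] with y hy hyS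
    by_cases hyη : ‖ψ y‖ < η
    · simp [hyη]
    · simp only [hyη, if_false, hy hyS (not_lt.1 hyη), id]
  · refine (hT.contDiffAt.congr_of_eventuallyEq ?_).contDiffWithinAt
    filter_upwards [continuousAt_const.eventually_lt hc hgt] with y hy
    simp [hy.le.not_gt]

/-- The two prescriptions agree where ‖ψ‖ = η, because the deflation A fixes the tube. -/
theorem exists_isMilnorMap (h : IsEulerSubmersion ψ L a R) (hε : 0 < ε) (hR : ε < R)
    (hη : 0 < η) {v : Euc m → Euc m} (hv : IsInflatingField ψ ε η v) :
    ∃ θ, IsMilnorMap ψ ε η v θ := by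
  obtain ⟨A, B, -, -, hA1, -, hA2, -, -, -⟩ := h.exists_tube_sphere_maps hε hR hη hv
  refine ⟨fun x => if η ≤ ‖ψ x‖ then normalized ψ (A x) else normalized ψ x, fun x hx hxη => ?_,
    fun x hx hxη => ⟨A x, ?_, by simp [hxη]⟩⟩
  · by_cases h1 : η ≤ ‖ψ x‖
    · simp only [h1, if_true, hA2 x (sphere_subset_closedBall hx.1) (hxη.antisymm h1)]
    · simp [h1]
  · obtain ⟨-, h2, h3⟩ := hA1 x ⟨sphere_subset_closedBall hx, hxη⟩
    exact inflatesTo_iff.2 ⟨h2, hx, h3⟩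

/-- A Milnor map is the composite of `ψ / ‖ψ‖` with a diffeomorphism of the sphere that fixes the
link pointwise. -/
theorem exists_diffeo_of_isMilnorMap (h : IsEulerSubmersion ψ L a R) (hε : 0 < ε) (hR : ε < R)
    (hη : 0 < η) {v : Euc m → Euc m} (hv : IsInflatingField ψ ε η v) {θ : Euc m → Euc p}
    (hθ : IsMilnorMap ψ ε η v θ) :
    ∃ Φ Ψ : Euc m → Euc m, ContDiffOn ℝ ∞ Φ (sphere 0 ε) ∧ ContDiffOn ℝ ∞ Ψ (sphere 0 ε) ∧
      MapsTo Φ (sphere 0 ε) (sphere 0 ε) ∧ MapsTo Ψ (sphere 0 ε) (sphere 0 ε) ∧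
      InvOn Ψ Φ (sphere 0 ε) (sphere 0 ε) ∧ (∀ x ∈ link ψ ε, Φ x = x) ∧
      ∀ x ∈ sphere 0 ε \ link ψ ε, normalized ψ (Φ x) = θ x := by
  obtain ⟨v', hv', hrad, hvv'⟩ := h.exists_radial_field hε hR hv
  obtain ⟨A, B, hA, hB, hA1, hB1, hA2, hA3, hA4, hB4⟩ := h.exists_tube_sphere_maps hε hR hη hv
  obtain ⟨A', B', hA', hB', hA1', hB1', hA2', hA3', hA4', hB4'⟩ :=
    h.exists_tube_sphere_maps hε hR hη hv'
  have hreg : ∀ x ∈ sphere (0 : Euc m) ε, ¬ ‖ψ x‖ < η → x ∈ outerRegion ψ ε η := fun x hx hlt =>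
    ⟨sphere_subset_closedBall hx, not_lt.1 hlt⟩
  have hmaps : ∀ {A B : Euc m → Euc m},
      (∀ x ∈ outerRegion ψ ε η, A x ∈ outerRegion ψ ε η) →
      (∀ x ∈ outerRegion ψ ε η, B x ∈ sphere (0 : Euc m) ε) →
      MapsTo (fun x => if ‖ψ x‖ < η then x else B (A x)) (sphere 0 ε) (sphere 0 ε) := by
    intro A B h1 h2 x hx
    by_cases hlt : ‖ψ x‖ < η
    · simpa only [hlt, if_true] using hx
    · simpa only [hlt, if_false] using h2 _ (h1 x (hreg x hx hlt))
  -- Stated for arbitrary maps because it serves both composites, with the roles of v and v'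
  -- exchanged.
  have hleft : ∀ {A B A' B' : Euc m → Euc m},
      (∀ x ∈ outerRegion ψ ε η, A x ∈ outerRegion ψ ε η ∧ ‖ψ (A x)‖ = η) →
      (∀ x ∈ outerRegion ψ ε η, B' x ∈ outerRegion ψ ε η) →
      (∀ x ∈ outerRegion ψ ε η, ‖ψ x‖ = η → A' (B' x) = x) →
      (∀ x ∈ outerRegion ψ ε η, x ∈ sphere (0 : Euc m) ε → B (A x) = x) →
      LeftInvOn (fun x => if ‖ψ x‖ < η then x else B (A' x))
        (fun x => if ‖ψ x‖ < η then x else B' (A x)) (sphere 0 ε) := by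
    intro A B A' B' h1 h2 h3 h4 x hx
    by_cases hlt : ‖ψ x‖ < η
    · simp only [hlt, if_true]
    · have hxK := hreg x hx hlt
      have h5 := h1 x hxK
      have h6 : ¬ ‖ψ (B' (A x))‖ < η := not_lt.2 (h2 _ h5.1).2
      simp only [hlt, if_false, h6, h3 _ h5.1 h5.2, h4 x hxK hx]
  refine ⟨fun x => if ‖ψ x‖ < η then x else B' (A x), fun x => if ‖ψ x‖ < η then x else B (A' x),
    h.contDiffOn_ite_tube hR (hB'.comp hA) ?_, h.contDiffOn_ite_tube hR (hB.comp hA') ?_,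
    hmaps (fun x hx => (hA1 x hx).1) (fun x hx => (hB1' x hx).2.1),
    hmaps (fun x hx => (hA1' x hx).1) (fun x hx => (hB1 x hx).2.1), ⟨?_, ?_⟩, ?_, ?_⟩
  · intro x₀ hx₀ h0
    -- Near the corner the whole trajectory from A x to x lies where v = v', so inflating A x along
    -- v' returns to x.
    filter_upwards [hA3 x₀ (sphere_subset_closedBall hx₀) h0 _
      (eventually_nhdsSet_iff_forall.1 hvv' x₀ ⟨hx₀, h0⟩)] with x hx hxS hxη
    have h1 := (hx ⟨sphere_subset_closedBall hxS, hxη⟩).congr (X' := v') fun z hz => hz.2.symm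
    exact (hB4' x _ (h1.mono inter_subset_left) hxS).symm
  · intro x₀ hx₀ h0
    filter_upwards [hA3' x₀ (sphere_subset_closedBall hx₀) h0 _
      (eventually_nhdsSet_iff_forall.1 hvv' x₀ ⟨hx₀, h0⟩)] with x hx hxS hxη
    have h1 := (hx ⟨sphere_subset_closedBall hxS, hxη⟩).congr (X' := v) fun z hz => hz.2
    exact (hB4 x _ (h1.mono inter_subset_left) hxS).symm
  · exact hleft (fun x hx => ⟨(hA1 x hx).1, (hA1 x hx).2.1⟩) (fun x hx => (hB1' x hx).1)
      (fun x hx h0 => (hA4' _ _ (hB1' x hx).2.2 h0).symm)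
      (fun x hx h0 => (hB4 _ _ (hA1 x hx).2.2 h0).symm)
  · exact hleft (fun x hx => ⟨(hA1' x hx).1, (hA1' x hx).2.1⟩) (fun x hx => (hB1 x hx).1)
      (fun x hx h0 => (hA4 _ _ (hB1 x hx).2.2 h0).symm)
      (fun x hx h0 => (hB4' _ _ (hA1' x hx).2.2 h0).symm)
  · intro x hx
    have : ‖ψ x‖ < η := by rwa [hx.2, norm_zero]
    simp only [this, if_true]
  · intro x hx
    by_cases hlt : ‖ψ x‖ < η
    · simp only [hlt, if_true, hθ.1 x hx hlt.le]
    · have hxK := hreg x hx.1 hlt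
      obtain ⟨y, hy, hyθ⟩ := hθ.2 x hx.1 hxK.2
      obtain ⟨hy1, -, hy2⟩ := inflatesTo_iff.1 hy
      -- The starting point y is forced to be A x, and inflation along v' does not change ψ/‖ψ‖.
      rw [hyθ, hA4 x y hy2 hy1]
      simp only [hlt, if_false]
      exact h.normalized_eq_of_flowsWithin hR hη hrad (hB1' _ (hA1 x hxK).1).2.2

theorem isOpenBook_and_equiv_of_isMilnorMap (h : IsEulerSubmersion ψ L a R) (hε : 0 < ε)
    (hR : ε < R) (hη : 0 < η) (hm : 0 < m) (hp : 2 ≤ p) {v : Euc m → Euc m}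
    (hv : IsInflatingField ψ ε η v) {θ : Euc m → Euc p} (hθ : IsMilnorMap ψ ε η v θ) :
    IsOpenBook ε (link ψ ε) θ ∧
      OpenBookEquiv ε (link ψ ε) θ (link ψ ε) (normalized ψ) := by
  obtain ⟨Φ, Ψ, hΦ, hΨ, hΦm, hΨm, hinv, hK, hθΦ⟩ := h.exists_diffeo_of_isMilnorMap hε hR hη hv hθ
  refine ⟨(h.isOpenBook_normalized hε hR hm hp).transport hΦ hΨ hΦm hΨm hinv hK hθΦ, Φ,
    ⟨hΦ, hΦm, Ψ, hΨ, hΨm, hinv⟩, ?_, hθΦ⟩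
  rw [image_congr hK, image_id']

end IsEulerSubmersion

/-! ### From weighted homogeneity to Euler's identity. -/

/-- The linear vector field generating the weighted dilations. -/
noncomputable def weightField (w : Fin m → ℕ) : Euc m →L[ℝ] Euc m :=
  LinearMap.toContinuousLinearMap
    { toFun := fun x => WithLp.toLp 2 fun j => (w j : ℝ) * x j
      map_add' := fun x y => by ext j; simp [mul_add]
      map_smul' := fun r x => by ext j; simp [mul_left_comm] }

@[simp]
theorem weightField_apply (w : Fin m → ℕ) (x : Euc m) (j : Fin m) :
    weightField w x j = w j * x j := rfl

theorem inner_weightField_pos {w : Fin m → ℕ} (hw : ∀ j, 0 < w j) {x : Euc m} (hx : x ≠ 0) :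
    0 < inner ℝ (weightField w x) x := by
  have h : inner ℝ (weightField w x) x = ∑ j, (w j : ℝ) * (x j) ^ 2 := by
    rw [PiLp.inner_apply]
    refine Finset.sum_congr rfl fun j _ => ?_
    simp only [weightField_apply, RCLike.inner_apply, conj_trivial]
    ring
  rw [h]
  obtain ⟨j, hj⟩ : ∃ j, x j ≠ 0 := by
    by_contra! h0
    exact hx (by ext j; simpa using h0 j)
  refine Finset.sum_pos' (fun i _ => by positivity) ⟨j, Finset.mem_univ j, ?_⟩
  have : (0 : ℝ) < w j := by exact_mod_cast hw j
  positivity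

theorem hasDerivAt_dilate (w : Fin m → ℕ) (x : Euc m) :
    HasDerivAt (fun t : ℝ => dilate w t x) (weightField w x) 1 := by
  have h : HasDerivAt (fun (t : ℝ) j => t ^ w j * x j) (fun j => (w j : ℝ) * x j) 1 :=
    hasDerivAt_pi.2 fun j => by simpa using (hasDerivAt_pow (w j) (1 : ℝ)).mul_const (x j)
  exact (PiLp.continuousLinearEquiv 2 ℝ fun _ : Fin m => ℝ).symm.hasFDerivAt.comp_hasDerivAt 1 h

theorem dilate_one (w : Fin m → ℕ) (x : Euc m) : dilate w 1 x = x := by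
  ext j
  simp [dilate]

theorem fderiv_euclidean_apply {ψ : Euc m → Euc p} {x : Euc m} (h : DifferentiableAt ℝ ψ x)
    (v : Euc m) (i : Fin p) : fderiv ℝ (fun y => ψ y i) x v = fderiv ℝ ψ x v i := by
  have h' := (EuclideanSpace.proj i : Euc p →L[ℝ] ℝ).hasFDerivAt.comp x h.hasFDerivAt
  exact congrArg (fun A => A v) h'.fderiv

/-- A vector c orthogonal to the range of dψ is a linear relation ∑ cᵢ∇ψᵢ = 0 between the gradients.
-/
theorem surjective_fderiv_of_notMem_singularLocus {ψ : Euc m → Euc p} {x : Euc m}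
    (h : DifferentiableAt ℝ ψ x) (hx : x ∉ singularLocus ψ) :
    Function.Surjective (fderiv ℝ ψ x) := by
  have hli : LinearIndependent ℝ fun i : Fin p => gradient (fun y => ψ y i) x := by
    by_contra hc
    exact hx hc
  rw [← ContinuousLinearMap.coe_coe, ← LinearMap.range_eq_top, ← Submodule.orthogonal_eq_bot_iff,
    Submodule.eq_bot_iff]
  intro c hc
  have h0 : ∑ i, c i • gradient (fun y => ψ y i) x = 0 := by
    refine ext_inner_left ℝ fun v => ?_
    rw [inner_sum, inner_zero_right]
    have h1 : inner ℝ (fderiv ℝ ψ x v) c = 0 := hc _ ⟨v, rfl⟩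
    rw [PiLp.inner_apply] at h1
    refine Eq.trans (Finset.sum_congr rfl fun i _ => ?_) h1
    rw [inner_smul_right, inner_gradient, fderiv_euclidean_apply h]
    simp
  ext i
  simpa using Fintype.linearIndependent_iff.1 hli _ h0 i

theorem IsWeightedHomogeneousGerm.exists_isEulerSubmersion {w : Fin m → ℕ} {α : ℕ}
    {ψ : Euc m → Euc p} (hψ : IsWeightedHomogeneousGerm w α ψ) (hsing : HasIsolatedSingularity ψ) :
    ∃ R : ℝ, 0 < R ∧ IsEulerSubmersion ψ (weightField w) α R := by
  obtain ⟨R, hR, hball⟩ := Metric.eventually_nhds_iff_ball.1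
    (hψ.analytic.eventually_analyticAt.and (hψ.homogeneous.and hsing))
  have hball' : ∀ x : Euc m, ‖x‖ < R → _ := fun x hx => hball x (by simpa using hx)
  have hd : ∀ x : Euc m, ‖x‖ < R → DifferentiableAt ℝ ψ x := fun x hx =>
    (hball' x hx).1.differentiableAt
  refine ⟨R, hR, by exact_mod_cast hψ.degree_pos, fun x hx => (hball' x hx).1.contDiffAt,
    fun x hx => inner_weightField_pos hψ.weight_pos hx, fun x hx => ?_, fun x h0 hx =>
    surjective_fderiv_of_notMem_singularLocus (hd x hx) fun hs => h0 ((hball' x hx).2.2 hs)⟩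
  have h1 : HasDerivAt (fun t : ℝ => ψ (dilate w t x)) (fderiv ℝ ψ x (weightField w x)) 1 := by
    have h2 : HasFDerivAt ψ (fderiv ℝ ψ x) (dilate w 1 x) := by
      rw [dilate_one]
      exact (hd x hx).hasFDerivAt
    exact h2.comp_hasDerivAt 1 (hasDerivAt_dilate w x)
  have h3 : HasDerivAt (fun t : ℝ => t ^ α • ψ x) ((α : ℝ) • ψ x) 1 := by
    have := (hasDerivAt_pow α (1 : ℝ)).smul_const (ψ x)
    simpa using this
  -- Homogeneity is given only for t ≤ 1, so the comparison at t = 1 is one-sided; this still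
  -- determines the derivative.
  have h4 : HasDerivWithinAt (fun t : ℝ => ψ (dilate w t x)) ((α : ℝ) • ψ x) (Iic 1) 1 := by
    refine h3.hasDerivWithinAt.congr_of_eventuallyEq_of_mem ?_ self_mem_Iic
    filter_upwards [self_mem_nhdsWithin, nhdsWithin_le_nhds (lt_mem_nhds one_pos)] with t ht ht0
    ext i
    simpa using (hball' x hx).2.1 t ht0 ht i
  exact (uniqueDiffOn_Iic (1 : ℝ) 1 self_mem_Iic).eq_deriv _ h1.hasDerivWithinAt h4

end HigherOpenBook

theorem theorem4p1 {m p : ℕ} (hp : 2 ≤ p) (hpm : p ≤ m)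
    (w : Fin m → ℕ) (α : ℕ) (ψ : HigherOpenBook.Euc m → HigherOpenBook.Euc p)
    (hψ : HigherOpenBook.IsWeightedHomogeneousGerm w α ψ)
    (hsing : HigherOpenBook.HasIsolatedSingularity ψ) :
    ∃ ε₀ : ℝ, 0 < ε₀ ∧ ∀ ε : ℝ, 0 < ε → ε ≤ ε₀ →
      HigherOpenBook.IsOpenBook ε (HigherOpenBook.link ψ ε) (HigherOpenBook.normalized ψ) ∧
      ∃ η₀ : ℝ, 0 < η₀ ∧ ∀ η : ℝ, 0 < η → η ≤ η₀ →
        (∃ v, HigherOpenBook.IsInflatingField ψ ε η v) ∧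
        ∀ v, HigherOpenBook.IsInflatingField ψ ε η v →
          (∃ θ, HigherOpenBook.IsMilnorMap ψ ε η v θ) ∧
          ∀ θ, HigherOpenBook.IsMilnorMap ψ ε η v θ →
            HigherOpenBook.IsOpenBook ε (HigherOpenBook.link ψ ε) θ ∧
            HigherOpenBook.OpenBookEquiv ε (HigherOpenBook.link ψ ε) θ
              (HigherOpenBook.link ψ ε) (HigherOpenBook.normalized ψ) := by
  obtain ⟨R, hR, h⟩ := hψ.exists_isEulerSubmersion hsing
  have hm : 0 < m := by omega
  refine ⟨R / 2, half_pos hR, fun ε hε hεR => ?_⟩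
  have hεR' : ε < R := hεR.trans_lt (half_lt_self hR)
  -- The bound 1 is arbitrary: the argument works for every η > 0.
  exact ⟨h.isOpenBook_normalized hε hεR' hm hp, 1, one_pos, fun η hη _ =>
    ⟨⟨_, h.isInflatingField_linear hε hεR' η⟩, fun v hv =>
      ⟨h.exists_isMilnorMap hε hεR' hη hv, fun θ hθ =>
        h.isOpenBook_and_equiv_of_isMilnorMap hε hεR' hη hm hp hv hθ⟩⟩⟩
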